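/- Let $k_A=\{x^2+(y+\frac12)^2=1,\ z=0\}$ and $k_B=\{(y-\frac12)^2+z^2=1,\ x=0\}$ in $\mathbb R^3$. The extended oloid is the developable surface formed by the generating lines $\{(1-m)A(t)+mB(t): m\in\mathbb R\}$, $t\in\mathbb R$, where for $t\in[-\frac{2\pi}3,\frac{2\pi}3]$ $$A(t)=\Big(\sin t,\,-\tfrac12-\cos t,\,0\Big)\in k_A,\qquad B(t)=\Big(0,\ \tfrac12-\tfrac{\cos t}{1+\cos t},\ -\tfrac{\sqrt{1+2\cos t}}{1+\cos t}\Big)\in k_B,$$ for $t\in[\frac{2\pi}3,2\pi]$ the lines are the mirror images in the plane $z=0$ of those with parameter $\frac{4\pi}3-t$, and the family is continued with period $\frac{8\pi}3$. (So $t$ is the arc length of the double circular arc described by $A(t)$ on $k_A$.) Its tangent plane along a generating line is the plane that contains the line, the tangent of $k_A$ at $A(t)$ and the tangent of $k_B$ at $B(t)$. For $\lambda\in\mathbb R\setminus\{0,1\}$ let $\mathcal Q_\lambda$ be the quadric $$\frac{x^2}{1-\lambda}+\frac{(y-\lambda+\frac12)^2}{1-\lambda+\lambda^2}+\frac{z^2}{\lambda}=1,$$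 and let $\mathcal Q_0=k_A$, $\mathcal Q_1=k_B$. The touching curve $\mathcal C_\lambda$ consists of the points of the generating lines that lie on $\mathcal Q_\lambda$ and at which the tangent plane (for $\lambda=0,1$: the tangent line) of $\mathcal Q_\lambda$ is contained in the tangent plane of the extended oloid along that generating line. Develop the extended oloid (continued periodically in $t$) onto its tangent plane $E$ along the generating line $t=0$: that is, map it continuously, generating lines affinely onto straight lines, isometrically and with preservation of orientation (without folds), such that the line $t=0$ stays fixed. In $E$ use cartesian coordinates $(\xi,\eta)$ with origin $A(0)$, $\eta$-axis along the line $t=0$ directed from $A(0)$ to $B(0)$, and $\xi$-axis in direction $A'(0)=(1,0,0)$; the orientation is the one for which at $t=0$ the development agrees with the identity of $E$. Then such a development exists, and for every such development and every $\lambda\in\mathbb R$ the curve $\mathcal C_\lambda$ is mapped onto the plane curve $$\mathcal C_\lambda^*=\{(\kappa_1^*(\lambda,t),\kappa_2^*(\lambda,t)) : t\in\mathbb R,\ 1+\lambda\cos h(t)\neq 0\},$$ where $$\kappa_1^*(\lambda,t)=\operatorname{sgn}(t)\Big\lfloor\frac{3|t|}{4\pi}+\frac12\Big\rfloor\frac{4\pi}{3\sqrt3}+\operatorname{sgn}(h(t))\,\tilde\kappa_1(\lambda,h(t)),\qquad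 \kappa_2^*(\lambda,t)=\tilde\kappa_2(\lambda,h(t)),$$ $$h(t)=t-\operatorname{sgn}(t)\Big\lfloor\frac{3|t|}{4\pi}+\frac12\Big\rfloor\frac{4\pi}{3},$$ and, with $c=\cos t$, $s=\sin t$, $$\tilde\kappa_1(\lambda,t)=\frac{2\sqrt3}{9}\left(\arccos\frac{\sqrt2\,c}{\sqrt{1+c}}+\frac{(1-2\lambda)\,|s|\sqrt{2(1+2c)}}{(1+\lambda c)\sqrt{1+c}}\right),$$ $$\tilde\kappa_2(\lambda,t)=\frac{\sqrt3}{9}\left(\ln\frac{2}{1+c}+\frac{4+7\lambda+(11\lambda-4)c}{1+\lambda c}\right).$$ More precisely, if $1+\lambda\cos h(t)\ne0$, then the generating line with parameter $t$ contains a point of $\mathcal C_\lambda$ at which the tangency condition holds along that line, and each such point is mapped to $(\kappa_1^*(\lambda,t),\kappa_2^*(\lambda,t))$; if $1+\lambda\cos h(t)=0$, there is no such point. -/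

import Mathlib

open scoped Matrix

noncomputable section

namespace Oloid

/-! ### The extended oloid

Points of space and of the plane are coordinate vectors `Fin 3 → ℝ`, `Fin 2 → ℝ`; the Euclidean
inner product is the dot product `⬝ᵥ`. -/

/-- The circle `k_A`. -/
def circleA : Set (Fin 3 → ℝ) := {p | p 0 ^ 2 + (p 1 + 1 / 2) ^ 2 = 1 ∧ p 2 = 0}

/-- The circle `k_B`. -/
def circleB : Set (Fin 3 → ℝ) := {p | (p 1 - 1 / 2) ^ 2 + p 2 ^ 2 = 1 ∧ p 0 = 0}

/-- The generating lines are indexed by `t ∈ ℝ`, the arc length of the double circular arc on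
`k_A` that is run through forwards for `-2π/3 ≤ t ≤ 2π/3`, backwards for `2π/3 ≤ t ≤ 2π`, and so
on periodically. `sheet t` is the number of turning points passed between `0` and `t`. -/
def sheet (t : ℝ) : ℤ := ⌊3 * t / (4 * Real.pi) + 1 / 2⌋

/-- The reduced parameter, in `[-2π/3, 2π/3)`. -/
def reduced (t : ℝ) : ℝ := t - sheet t * (4 * Real.pi / 3)

/-- The sign `(-1) ^ sheet t`; it changes at the turning points. -/
def sheetSign (t : ℝ) : ℝ := (-1 : ℝ) ^ sheet t

/-- The point `A` of `k_A` on the generating line with index `t`. On `[-2π/3, 2π/3]` this is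
`(sin t, -1/2 - cos t, 0)`, on `[2π/3, 2π]` it is the same expression at `4π/3 - t`. -/
def pointA (t : ℝ) : Fin 3 → ℝ :=
  ![sheetSign t * Real.sin (reduced t), -1 / 2 - Real.cos (reduced t), 0]

/-- The point `B` of `k_B` on the generating line with index `t`. For `t ∈ (-2π/3, 2π/3)` it is
the one of the two possible points that has negative third coordinate; on the next interval it
is the other one, and so on alternately. -/
def pointB (t : ℝ) : Fin 3 → ℝ :=
  ![0, 1 / 2 - Real.cos (reduced t) / (1 + Real.cos (reduced t)),
    -sheetSign t * (Real.sqrt (1 + 2 * Real.cos (reduced t)) / (1 + Real.cos (reduced t)))]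

/-- The parametrization `(t, m) ↦ (1 - m) A(t) + m B(t)` of the extended oloid by its generating
lines (periodic in `t` with period `8π/3`). -/
def surface (t m : ℝ) : Fin 3 → ℝ := (1 - m) • pointA t + m • pointB t

/-- The direction of the tangent plane of the extended oloid along the generating line with
index `t`. This plane contains the generating line, the tangent of `k_A` at `A(t)` and the tangent
of `k_B` at `B(t)`. -/
def tangentDir (t : ℝ) : Submodule ℝ (Fin 3 → ℝ) :=
  Submodule.span ℝ {pointB t - pointA t,
    ![pointA t 1 + 1 / 2, -pointA t 0, 0],
    ![0, pointB t 2, -(pointB t 1 - 1 / 2)]}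

/-! ### The inscribed quadrics and their touching curves -/

/-- The left-hand side of the equation of the inscribed quadric (for `lam ≠ 0, 1`). -/
def quadricFun (lam : ℝ) (p : Fin 3 → ℝ) : ℝ :=
  p 0 ^ 2 / (1 - lam) + (p 1 - lam + 1 / 2) ^ 2 / (1 - lam + lam ^ 2) + p 2 ^ 2 / lam - 1

open scoped Classical in
/-- The inscribed quadric; for `lam = 0` and `lam = 1` it is the circle `k_A`, `k_B`. -/
def quadric (lam : ℝ) : Set (Fin 3 → ℝ) :=
  if lam = 0 then circleA else if lam = 1 then circleB else {p | quadricFun lam p = 0}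

open scoped Classical in
/-- The tangent vectors of the inscribed quadric (or circle) at one of its points `p`. -/
def quadricTangent (lam : ℝ) (p : Fin 3 → ℝ) : Set (Fin 3 → ℝ) :=
  if lam = 0 then {v | p 0 * v 0 + (p 1 + 1 / 2) * v 1 = 0 ∧ v 2 = 0}
  else if lam = 1 then {v | (p 1 - 1 / 2) * v 1 + p 2 * v 2 = 0 ∧ v 0 = 0}
  else {v | lineDeriv ℝ (quadricFun lam) p v = 0}

/-- The surface point with parameters `(t, m)` belongs to the touching curve: it lies on the
quadric, and all tangents of the quadric there lie in the tangent plane of the extended oloid. -/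
def Touches (lam t m : ℝ) : Prop :=
  surface t m ∈ quadric lam ∧ quadricTangent lam (surface t m) ⊆ tangentDir t

/-! ### The development -/

/-- The unit vector of the `ξ`-axis in the tangent plane `E` along the generating line `t = 0`
(the tangent direction of `k_A` at `A(0)`). -/
def axisXi : Fin 3 → ℝ := ![1, 0, 0]

/-- The unit vector of the `η`-axis in `E`: the direction of the generating line `t = 0`. -/
def axisEta : Fin 3 → ℝ := (Real.sqrt 3)⁻¹ • (pointB 0 - pointA 0)

/-- The point of `E` with given coordinates `(ξ, η)`. -/
def planeE (p : Fin 2 → ℝ) : Fin 3 → ℝ := pointA 0 + p 0 • axisXi + p 1 • axisEta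

/-- `D t m ∈ ℝ²` are the `(ξ, η)`-coordinates of the image of the surface point with parameters
`(t, m)` when the extended oloid is developed (unrolled without fold) onto `E`. The conditions on
derivatives refer to the indices `t` other than the turning points `2π/3 + j · 4π/3`, at which the
parametrization by `t` is not differentiable. -/
structure IsDevelopment (D : ℝ → ℝ → Fin 2 → ℝ) : Prop where
  /-- The development does not tear the surface. -/
  continuous : Continuous fun q : ℝ × ℝ => D q.1 q.2
  /-- Generating lines are mapped affinely to straight lines. -/
  ruled : ∀ t m, D t m = (1 - m) • D t 0 + m • D t 1
  /-- The generating line `t = 0` stays fixed. -/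
  fixed : ∀ m, planeE (D 0 m) = surface 0 m
  differentiable : ∀ t m, (∀ j : ℤ, t ≠ 2 * Real.pi / 3 + j * (4 * Real.pi / 3)) →
    DifferentiableAt ℝ (fun u => D u m) t
  /-- The first fundamental form is preserved. -/
  isometric_mm : ∀ t, (D t 1 - D t 0) ⬝ᵥ (D t 1 - D t 0) =
    (pointB t - pointA t) ⬝ᵥ (pointB t - pointA t)
  isometric_tm : ∀ t m, (∀ j : ℤ, t ≠ 2 * Real.pi / 3 + j * (4 * Real.pi / 3)) →
    deriv (fun u => D u m) t ⬝ᵥ (D t 1 - D t 0) =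
      deriv (fun u => surface u m) t ⬝ᵥ (pointB t - pointA t)
  isometric_tt : ∀ t m, (∀ j : ℤ, t ≠ 2 * Real.pi / 3 + j * (4 * Real.pi / 3)) →
    deriv (fun u => D u m) t ⬝ᵥ deriv (fun u => D u m) t =
      deriv (fun u => surface u m) t ⬝ᵥ deriv (fun u => surface u m) t
  /-- The orientation is preserved: with respect to the continuous unit normal `N` of the tangent
  planes that at `t = 0` agrees with the orientation of `E` given by the `ξ,η`-axes, signed areas
  are preserved. -/
  oriented : ∃ N : ℝ → Fin 3 → ℝ, Continuous N ∧ N 0 = axisXi ⨯₃ axisEta ∧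
    (∀ t, N t ⬝ᵥ N t = 1 ∧ ∀ v ∈ tangentDir t, N t ⬝ᵥ v = 0) ∧
    ∀ t m, (∀ j : ℤ, t ≠ 2 * Real.pi / 3 + j * (4 * Real.pi / 3)) →
      deriv (fun u => D u m) t 0 * (D t 1 - D t 0) 1
          - deriv (fun u => D u m) t 1 * (D t 1 - D t 0) 0 =
        (deriv (fun u => surface u m) t ⨯₃ (pointB t - pointA t)) ⬝ᵥ N t

/-! ### The explicit plane curve -/

/-- The step function `⌊3|t|/(4π) + 1/2⌋`. -/
def step (t : ℝ) : ℝ := (⌊3 * |t| / (4 * Real.pi) + 1 / 2⌋ : ℤ)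

/-- The function `h`. -/
def h (t : ℝ) : ℝ := t - Real.sign t * step t * (4 * Real.pi / 3)

/-- The first coordinate on the fundamental interval, up to sign. -/
def kappaTilde1 (lam t : ℝ) : ℝ :=
  2 * Real.sqrt 3 / 9 *
    (Real.arccos (Real.sqrt 2 * Real.cos t / Real.sqrt (1 + Real.cos t)) +
      (1 - 2 * lam) * |Real.sin t| * Real.sqrt (2 * (1 + 2 * Real.cos t)) /
        ((1 + lam * Real.cos t) * Real.sqrt (1 + Real.cos t)))

/-- The second coordinate on the fundamental interval. -/
def kappaTilde2 (lam t : ℝ) : ℝ :=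
  Real.sqrt 3 / 9 *
    (Real.log (2 / (1 + Real.cos t)) +
      (4 + 7 * lam + (11 * lam - 4) * Real.cos t) / (1 + lam * Real.cos t))

/-- The plane curve `t ↦ (κ₁*(λ, t), κ₂*(λ, t))`. -/
def kappaStar (lam t : ℝ) : Fin 2 → ℝ :=
  ![Real.sign t * step t * (4 * Real.pi / (3 * Real.sqrt 3)) +
      Real.sign (h t) * kappaTilde1 lam (h t),
    kappaTilde2 lam (h t)]

end Oloid

end

noncomputable section

namespace Oloid

/-! ### The reduced parameter -/

/-! The proof has two independent halves: locating the touching point on each generating line, and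
identifying the development.

Touching points. With c = cos u, s = sin u, r = √(1+2c) (u the reduced parameter) and σ the sheet
sign, n = (σs, -c, -σr) is normal to the tangent plane, and the plane has equation n·(p - z) = 1 +
λc, where z = (0, λ-1/2, 0) is the centre of the quadric. Tangency at p means n = μg with g half the
gradient, and g·(p - z) = 1 on the quadric, so μ = 1 + λc. Hence μ = 0 is impossible, and comparing
coordinates gives m = λ(1+c)/(1+λc). The two circles obey the same formula (`touches_iff`).

Development. Existence is by an explicit map: take the claimed curves for λ = 0 and λ = 1 as images
of A(t) and B(t) and extend affinely along the lines. In terms of p = sin(u/2), q = cos(u/2) and r,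
which satisfy p² = 1 - q² and r² = 4q² - 1, the isometry and orientation conditions are algebraic
identities (`vel_dot_line`, `vel_dot_vel`, `vel_cross_line`). The pieces on the sheets fit together
because the first coordinates are odd and end at half the translation 4π/(3√3) (`continuous_sheet`).

Uniqueness (`IsDevelopment.unique`): the developed segment AB has constant length √3 and its angular
speed is fixed by the area condition, so its direction is determined by the initial line; the
velocity of the image of A is then determined by its inner product and cross product with that
segment.

Finally, since a development is affine on each line, the image of the touching point is the
combination of the two curves with weight m. The arccos and log terms are common to both and survive
unchanged, which yields the stated formulas (`kappaStar_eq_dev`). -/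

theorem reduced_mem (t : ℝ) :
    -(2 * Real.pi / 3) ≤ reduced t ∧ reduced t < 2 * Real.pi / 3 := by
  have hpi := Real.pi_pos
  have h1 := Int.floor_le (3 * t / (4 * Real.pi) + 1 / 2)
  have h2 := Int.lt_floor_add_one (3 * t / (4 * Real.pi) + 1 / 2)
  have h3 : 3 * t / (4 * Real.pi) * (4 * Real.pi / 3) = t := by field_simp
  unfold reduced sheet
  constructor <;> nlinarith

/-- On a sheet the half angle stays within π/3 of 0. This bound keeps every denominator cos(u/2) and
1 + cos u away from zero. -/
theorem half_le_cos_half {u : ℝ} (h₁ : -(2 * Real.pi / 3) ≤ u) (h₂ : u ≤ 2 * Real.pi / 3) :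
    1 / 2 ≤ Real.cos (u / 2) := by
  have hpi := Real.pi_pos
  rw [← Real.cos_abs, ← Real.cos_pi_div_three]
  apply Real.cos_le_cos_of_nonneg_of_le_pi (abs_nonneg _) (by linarith)
  rw [abs_le]; constructor <;> linarith

theorem half_lt_cos_half {u : ℝ} (h₁ : -(2 * Real.pi / 3) < u) (h₂ : u < 2 * Real.pi / 3) :
    1 / 2 < Real.cos (u / 2) := by
  have hpi := Real.pi_pos
  rw [← Real.cos_abs, ← Real.cos_pi_div_three]
  apply Real.cos_lt_cos_of_nonneg_of_le_pi (abs_nonneg _) (by linarith)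
  rw [abs_lt]; constructor <;> linarith

theorem cos_eq_half (u : ℝ) : Real.cos u = 2 * Real.cos (u / 2) ^ 2 - 1 := by
  rw [← Real.cos_two_mul]; congr 1; ring

theorem sin_eq_half (u : ℝ) : Real.sin u = 2 * Real.sin (u / 2) * Real.cos (u / 2) := by
  rw [← Real.sin_two_mul]; congr 1; ring

theorem neg_half_le_cos {u : ℝ} (h₁ : -(2 * Real.pi / 3) ≤ u) (h₂ : u ≤ 2 * Real.pi / 3) :
    -(1 / 2) ≤ Real.cos u := by
  have := half_le_cos_half h₁ h₂
  rw [cos_eq_half]; nlinarith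

theorem neg_half_le_cos_reduced (t : ℝ) : -(1 / 2) ≤ Real.cos (reduced t) :=
  neg_half_le_cos (reduced_mem t).1 (reduced_mem t).2.le

theorem sheetSign_sq (t : ℝ) : sheetSign t ^ 2 = 1 := by
  unfold sheetSign
  rcases Int.even_or_odd (sheet t) with h | h
  · rw [h.neg_one_zpow]; norm_num
  · rw [h.neg_one_zpow]; norm_num

/-! ### The normal of the tangent planes -/

/-- A normal vector of the tangent plane along the generating line with index `t`. -/
def normal (t : ℝ) : Fin 3 → ℝ :=
  ![sheetSign t * Real.sin (reduced t), -Real.cos (reduced t),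
    -sheetSign t * Real.sqrt (1 + 2 * Real.cos (reduced t))]

theorem sqrt_sq_reduced (t : ℝ) :
    Real.sqrt (1 + 2 * Real.cos (reduced t)) ^ 2 = 1 + 2 * Real.cos (reduced t) :=
  Real.sq_sqrt (by linarith [neg_half_le_cos_reduced t])

theorem normal_dot_of_mem {t : ℝ} {v : Fin 3 → ℝ} (hv : v ∈ tangentDir t) :
    normal t ⬝ᵥ v = 0 := by
  have hc := neg_half_le_cos_reduced t
  have hr := sqrt_sq_reduced t
  have hs := Real.sin_sq_add_cos_sq (reduced t)
  have hσ := sheetSign_sq t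
  have hc' : 1 + Real.cos (reduced t) ≠ 0 := by linarith
  induction hv using Submodule.span_induction with
  | mem x hx =>
    simp only [Set.mem_insert_iff, Set.mem_singleton_iff] at hx
    rcases hx with rfl | rfl | rfl <;>
    simp only [normal, pointA, pointB, dotProduct, Fin.sum_univ_three, Matrix.cons_val,
      Pi.sub_apply] <;>
    generalize Real.sqrt (1 + 2 * Real.cos (reduced t)) = r at * <;>
    generalize Real.cos (reduced t) = c at * <;>
    generalize Real.sin (reduced t) = s at * <;>
    generalize sheetSign t = σ at * <;> field_simp <;> grind
  | zero => simp
  | add x y _ _ hx hy => rw [dotProduct_add, hx, hy, add_zero]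
  | smul a x _ hx => rw [dotProduct_smul, hx, smul_zero]

theorem mem_tangentDir_of_normal_dot {t : ℝ} {v : Fin 3 → ℝ} (hv : normal t ⬝ᵥ v = 0) :
    v ∈ tangentDir t := by
  have hc := neg_half_le_cos_reduced t
  have hr := sqrt_sq_reduced t
  have hs := Real.sin_sq_add_cos_sq (reduced t)
  have hσ := sheetSign_sq t
  have hc' : 1 + Real.cos (reduced t) ≠ 0 := by linarith
  unfold tangentDir
  rw [Submodule.mem_span_triple]
  simp only [normal, dotProduct, Fin.sum_univ_three, Matrix.cons_val] at hv
  -- When the cosine vanishes, both circle tangents point in the y-direction, so the generating line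
  -- must supply the second direction. Otherwise the two tangents alone span the plane.
  by_cases h0 : Real.cos (reduced t) = 0
  · refine ⟨-sheetSign t * Real.sin (reduced t) * v 0,
      -sheetSign t * Real.sin (reduced t) * (v 1 + sheetSign t * Real.sin (reduced t) * v 0),
      0, ?_⟩
    ext i
    fin_cases i <;>
    simp only [pointA, pointB, Matrix.cons_val, Pi.sub_apply, Pi.add_apply, Pi.smul_apply,
      smul_eq_mul, Fin.zero_eta, Fin.mk_one, Fin.reduceFinMk] <;>
    generalize Real.sqrt (1 + 2 * Real.cos (reduced t)) = r at * <;>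
    generalize Real.cos (reduced t) = c at * <;>
    subst h0 <;>
    generalize Real.sin (reduced t) = s at * <;>
    generalize sheetSign t = σ at * <;> grind
  · refine ⟨0, -v 0 / Real.cos (reduced t),
      v 2 * (1 + Real.cos (reduced t)) / Real.cos (reduced t), ?_⟩
    ext i
    fin_cases i <;>
    simp only [pointA, pointB, Matrix.cons_val, Pi.sub_apply, Pi.add_apply, Pi.smul_apply,
      smul_eq_mul, Fin.zero_eta, Fin.mk_one, Fin.reduceFinMk] <;>
    generalize Real.sqrt (1 + 2 * Real.cos (reduced t)) = r at * <;>
    generalize Real.cos (reduced t) = c at * <;>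
    generalize Real.sin (reduced t) = s at * <;>
    generalize sheetSign t = σ at * <;> field_simp <;> grind

theorem mem_tangentDir_iff {t : ℝ} {v : Fin 3 → ℝ} :
    v ∈ tangentDir t ↔ normal t ⬝ᵥ v = 0 :=
  ⟨normal_dot_of_mem, mem_tangentDir_of_normal_dot⟩

theorem normal_dot_self (t : ℝ) : normal t ⬝ᵥ normal t = 2 * (1 + Real.cos (reduced t)) := by
  have hr := sqrt_sq_reduced t
  have hs := Real.sin_sq_add_cos_sq (reduced t)
  have hσ := sheetSign_sq t
  simp only [normal, dotProduct, Fin.sum_univ_three, Matrix.cons_val]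
  grind

/-- A vector orthogonal to all vectors orthogonal to `g` is a multiple of `g`. -/
theorem exists_smul_of_orthogonal {n g : Fin 3 → ℝ}
    (h : ∀ v : Fin 3 → ℝ, g ⬝ᵥ v = 0 → n ⬝ᵥ v = 0) : ∃ μ : ℝ, n = μ • g := by
  -- If n - μg is orthogonal to g, it is also orthogonal to n, hence to itself. It remains to take
  -- for μ the projection coefficient of n on g.
  have key : ∀ μ : ℝ, g ⬝ᵥ (n - μ • g) = 0 → n = μ • g := by
    intro μ h1
    have h2 := h _ h1
    have h3 : (n - μ • g) ⬝ᵥ (n - μ • g) = 0 := by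
      rw [sub_dotProduct, smul_dotProduct, h1, h2]; simp
    exact sub_eq_zero.1 (dotProduct_self_eq_zero.1 h3)
  by_cases hg : g ⬝ᵥ g = 0
  · rw [dotProduct_self_eq_zero] at hg
    exact ⟨0, key 0 (by simp [hg])⟩
  · refine ⟨(g ⬝ᵥ n) / (g ⬝ᵥ g), key _ ?_⟩
    rw [dotProduct_sub, dotProduct_smul, smul_eq_mul, div_mul_cancel₀ _ hg, sub_self]

/-! ### The touching points -/

theorem surface_apply (t m : ℝ) :
    surface t m = ![(1 - m) * (sheetSign t * Real.sin (reduced t)),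
      (1 - m) * (-1 / 2 - Real.cos (reduced t)) +
        m * (1 / 2 - Real.cos (reduced t) / (1 + Real.cos (reduced t))),
      m * (-sheetSign t *
        (Real.sqrt (1 + 2 * Real.cos (reduced t)) / (1 + Real.cos (reduced t))))] := by
  ext i
  fin_cases i <;> simp [surface, pointA, pointB]

/-- Half the gradient of the quadric function. -/
def quadricGrad (lam : ℝ) (p : Fin 3 → ℝ) : Fin 3 → ℝ :=
  ![p 0 / (1 - lam), (p 1 - lam + 1 / 2) / (1 - lam + lam ^ 2), p 2 / lam]

theorem lineDeriv_quadricFun (lam : ℝ) (p v : Fin 3 → ℝ) :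
    lineDeriv ℝ (quadricFun lam) p v = 2 * (quadricGrad lam p ⬝ᵥ v) := by
  have hx (i : Fin 3) (a : ℝ) : HasDerivAt (fun τ : ℝ => (p i + τ * v i - a) ^ 2)
      (2 * (p i - a) * v i) 0 := by
    have := ((((hasDerivAt_id (0 : ℝ)).mul_const (v i)).const_add (p i)).sub_const a).pow 2
    refine this.congr_deriv ?_
    simp
  have h := ((((hx 0 0).div_const (1 - lam)).add ((hx 1 (lam - 1 / 2)).div_const
    (1 - lam + lam ^ 2))).add ((hx 2 0).div_const lam)).sub_const 1
  have : HasLineDerivAt ℝ (quadricFun lam) (2 * (quadricGrad lam p ⬝ᵥ v)) p v := by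
    unfold HasLineDerivAt
    convert h using 1
    · ext τ
      simp [quadricFun]
      ring
    · simp only [quadricGrad, dotProduct, Fin.sum_univ_three, Matrix.cons_val]
      ring
  exact this.lineDeriv

theorem touches_zero_iff (t m : ℝ) : Touches 0 t m ↔ m = 0 := by
  have hc := neg_half_le_cos_reduced t
  have hr := sqrt_sq_reduced t
  have hs := Real.sin_sq_add_cos_sq (reduced t)
  have hσ := sheetSign_sq t
  have hc' : 1 + Real.cos (reduced t) ≠ 0 := by linarith
  simp only [Touches, quadric, quadricTangent, if_true, Set.subset_def, Set.mem_ofPred_eq,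
    SetLike.mem_coe, mem_tangentDir_iff, circleA, surface_apply, normal, dotProduct,
    Fin.sum_univ_three, Matrix.cons_val]
  generalize Real.sqrt (1 + 2 * Real.cos (reduced t)) = r at *
  generalize Real.cos (reduced t) = c at *
  generalize Real.sin (reduced t) = s at *
  generalize sheetSign t = σ at *
  have hσ0 : σ ≠ 0 := by rintro rfl; norm_num at hσ
  constructor
  · rintro ⟨⟨h1, h2⟩, -⟩
    -- For r = 0 the generating line lies in the plane of the circle and the height gives no
    -- information; but the line is tangent to the circle at A, so m = 0 is a double root.
    by_cases hr0 : r = 0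
    · have hc2 : c = -(1 / 2) := by rw [hr0] at hr; linarith
      have h3 : s ^ 2 = 3 / 4 := by rw [hc2] at hs; linarith
      rw [hc2] at h1
      have h4 : (1 - m) ^ 2 * (σ ^ 2 * s ^ 2) +
        ((1 - m) * (-1 / 2 - -(1 / 2)) + m * (1 / 2 - -(1 / 2) / (1 + -(1 / 2))) + 1 / 2) ^ 2
          = 1 := by linear_combination h1
      rw [h3, hσ] at h4
      norm_num at h4
      have : m ^ 2 = 0 := by nlinarith
      exact pow_eq_zero_iff (two_ne_zero) |>.1 this
    · have : σ * (r / (1 + c)) ≠ 0 := mul_ne_zero hσ0 (div_ne_zero hr0 hc')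
      have h5 : m * (σ * (r / (1 + c))) = 0 := by linarith
      exact (mul_eq_zero.1 h5).resolve_right this
  · rintro rfl
    refine ⟨⟨by grind, by ring⟩, ?_⟩
    rintro v ⟨h1, h2⟩
    rw [h2]
    linarith

theorem sin_reduced_eq_zero {t : ℝ} (h : Real.sin (reduced t) = 0) :
    Real.cos (reduced t) = 1 := by
  have h1 := Real.sin_sq_add_cos_sq (reduced t)
  have h2 := neg_half_le_cos_reduced t
  rw [h] at h1
  have : (Real.cos (reduced t) - 1) * (Real.cos (reduced t) + 1) = 0 := by nlinarith
  rcases mul_eq_zero.1 this with h3 | h3 <;> linarith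

theorem touches_one_iff (t m : ℝ) : Touches 1 t m ↔ m = 1 := by
  have hc := neg_half_le_cos_reduced t
  have hr := sqrt_sq_reduced t
  have hs := Real.sin_sq_add_cos_sq (reduced t)
  have hσ := sheetSign_sq t
  have hc' : 1 + Real.cos (reduced t) ≠ 0 := by linarith
  have hs0 := sin_reduced_eq_zero (t := t)
  simp only [Touches, quadric, quadricTangent, one_ne_zero, if_false, if_true, Set.subset_def,
    Set.mem_ofPred_eq, SetLike.mem_coe, mem_tangentDir_iff, circleB, surface_apply, normal,
    dotProduct, Fin.sum_univ_three, Matrix.cons_val]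
  generalize Real.sqrt (1 + 2 * Real.cos (reduced t)) = r at *
  generalize Real.cos (reduced t) = c at *
  generalize Real.sin (reduced t) = s at *
  generalize sheetSign t = σ at *
  have hσ0 : σ ≠ 0 := by rintro rfl; norm_num at hσ
  constructor
  · rintro ⟨⟨h1, h2⟩, -⟩
    -- The mirror situation: here the line lies in the plane x = 0 and is tangent to k_B at B.
    by_cases h0 : s = 0
    · have hc1 := hs0 h0
      rw [hc1] at h1 hr
      have h4 : ((1 - m) * (-1 / 2 - 1) + m * (1 / 2 - 1 / (1 + 1)) - 1 / 2) ^ 2 +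
        m ^ 2 * (σ ^ 2 * r ^ 2) / 4 = 1 := by linear_combination h1
      rw [hr, hσ] at h4
      norm_num at h4
      have : (m - 1) ^ 2 = 0 := by nlinarith
      have := pow_eq_zero_iff (two_ne_zero) |>.1 this
      linarith
    · have h5 := (mul_eq_zero.1 h2).resolve_right (mul_ne_zero hσ0 h0)
      linarith
  · rintro rfl
    refine ⟨⟨?_, by ring⟩, ?_⟩
    · field_simp
      grind
    · rintro v ⟨h1, h2⟩
      rw [h2]
      field_simp at h1
      linarith

theorem touches_iff_of_ne {lam : ℝ} (h0 : lam ≠ 0) (h1 : lam ≠ 1) (t m : ℝ) :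
    Touches lam t m ↔ 1 + lam * Real.cos (reduced t) ≠ 0 ∧
      m = lam * (1 + Real.cos (reduced t)) / (1 + lam * Real.cos (reduced t)) := by
  have hc := neg_half_le_cos_reduced t
  have hr := sqrt_sq_reduced t
  have hs := Real.sin_sq_add_cos_sq (reduced t)
  have hσ := sheetSign_sq t
  have hc' : 1 + Real.cos (reduced t) ≠ 0 := by linarith
  have hs0 := sin_reduced_eq_zero (t := t)
  have hl1 : 1 - lam ≠ 0 := sub_ne_zero.2 h1.symm
  have hl2 : 1 - lam + lam ^ 2 ≠ 0 := by nlinarith [sq_nonneg (lam - 1 / 2)]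
  have hnn := normal_dot_self t
  have hT : Touches lam t m ↔ quadricFun lam (surface t m) = 0 ∧
      ∀ v, quadricGrad lam (surface t m) ⬝ᵥ v = 0 → normal t ⬝ᵥ v = 0 := by
    simp only [Touches, quadric, quadricTangent, if_neg h0, if_neg h1, Set.subset_def,
      Set.mem_ofPred_eq, SetLike.mem_coe, mem_tangentDir_iff, lineDeriv_quadricFun,
      mul_eq_zero, OfNat.ofNat_ne_zero, false_or]
  rw [hT]
  constructor
  · rintro ⟨hq, hv⟩
    obtain ⟨μ, hμ⟩ := exists_smul_of_orthogonal hv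
    have e0 := congrFun hμ 0
    have e1 := congrFun hμ 1
    have e2 := congrFun hμ 2
    have hμ0 : μ ≠ 0 := by
      rintro rfl
      rw [zero_smul] at hμ
      rw [hμ, dotProduct_zero] at hnn
      apply hc'; linarith
    simp only [surface_apply, quadricFun, quadricGrad, normal, Pi.smul_apply, smul_eq_mul,
      Matrix.cons_val] at e0 e1 e2 hq
    clear hμ hv hT hnn
    generalize Real.sqrt (1 + 2 * Real.cos (reduced t)) = r at *
    generalize Real.cos (reduced t) = c at *
    generalize Real.sin (reduced t) = s at *
    generalize sheetSign t = σ at *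
    have hσ0 : σ ≠ 0 := by rintro rfl; norm_num at hσ
    obtain ⟨y, hy⟩ : ∃ y, y = (1 - m) * (-1 / 2 - c) + m * (1 / 2 - c / (1 + c)) := ⟨_, rfl⟩
    obtain ⟨z, hz⟩ : ∃ z, z = m * (-σ * (r / (1 + c))) := ⟨_, rfl⟩
    -- The equation of the tangent plane, relative to the centre of the quadric; the right-hand side
    -- does not depend on m.
    have hplane : (σ * s) * ((1 - m) * (σ * s)) + (-c) * (y - lam + 1 / 2) + (-σ * r) * z
        = 1 + lam * c := by
      rw [hy, hz]
      field_simp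
      linear_combination 2 * (1 - m) * (1 + c) * hs +
        2 * ((1 - m) * (1 + c) * s ^ 2 + m * r ^ 2) * hσ + 2 * m * hr
    rw [← hy] at e1 hq
    rw [← hz] at e2 hq
    -- Pair n = μg with the vector from the centre to the point: the quadric equation says that g
    -- gives 1, and `hplane` evaluates n.
    have hμc : μ = 1 + lam * c := by
      linear_combination (-μ) * hq + hplane - (1 - m) * (σ * s) * e0 - (y - lam + 1 / 2) * e1
        - z * e2
    subst hμc
    refine ⟨hμ0, ?_⟩
    rw [eq_div_iff hμ0]
    -- The x-coordinates determine m unless s = 0; then c = 1 and r ≠ 0, so the z-coordinates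
    -- determine it.
    by_cases hs' : s = 0
    · have hc1 := hs0 hs'
      subst hc1
      have hr0 : r ≠ 0 := by rintro rfl; norm_num at hr
      rw [hz] at e2
      field_simp at e2
      linarith
    · have : (1 - lam) * (σ * s) = (1 + lam * c) * ((1 - m) * (σ * s)) := by
        nth_rewrite 1 [e0]; field_simp
      have : (1 - lam) = (1 + lam * c) * (1 - m) :=
        mul_right_cancel₀ (mul_ne_zero hσ0 hs') (by linarith)
      linarith
  · rintro ⟨hk, hm⟩
    clear hT hnn
    generalize hr' : Real.sqrt (1 + 2 * Real.cos (reduced t)) = r at *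
    generalize hc'' : Real.cos (reduced t) = c at *
    generalize hs' : Real.sin (reduced t) = s at *
    generalize hσ' : sheetSign t = σ at *
    have a0 : (1 - lam * (1 + c) / (1 + lam * c)) * (σ * s) =
      (1 - lam) * (σ * s) / (1 + lam * c) := by field_simp; ring
    have a1 : (1 - lam * (1 + c) / (1 + lam * c)) * (-1 / 2 - c) +
      lam * (1 + c) / (1 + lam * c) * (1 / 2 - c / (1 + c)) - lam + 1 / 2 =
      -(1 - lam + lam ^ 2) * c / (1 + lam * c) := by field_simp; ring
    have a2 : lam * (1 + c) / (1 + lam * c) * (-σ * (r / (1 + c))) =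
      -lam * (σ * r) / (1 + lam * c) := by field_simp
    have hk' : 1 + c * lam ≠ 0 := by rwa [mul_comm c]
    have hg : normal t = (1 + lam * c) • quadricGrad lam (surface t m) := by
      ext i
      fin_cases i <;>
      simp only [surface_apply, quadricGrad, normal, Pi.smul_apply, smul_eq_mul,
        Matrix.cons_val, Fin.zero_eta, Fin.mk_one, Fin.reduceFinMk, hr', hc'', hs', hσ', hm,
        a0, a1, a2] <;> field_simp
    refine ⟨?_, fun v hv => by rw [hg, smul_dotProduct, hv, smul_zero]⟩
    simp only [surface_apply, quadricFun, Matrix.cons_val, hr', hc'', hs', hσ', hm]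
    rw [a0, a1, a2]
    have : (1 - lam) * (σ ^ 2 * s ^ 2) + (1 - lam + lam ^ 2) * c ^ 2 + lam * (σ ^ 2 * r ^ 2)
      = (1 + lam * c) ^ 2 := by
      rw [hσ, hr]; linear_combination (1 - lam) * hs
    field_simp
    linear_combination this

theorem touches_iff (lam t m : ℝ) :
    Touches lam t m ↔ 1 + lam * Real.cos (reduced t) ≠ 0 ∧
      m = lam * (1 + Real.cos (reduced t)) / (1 + lam * Real.cos (reduced t)) := by
  have hc := neg_half_le_cos_reduced t
  by_cases h0 : lam = 0
  · subst h0; simp [touches_zero_iff]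
  by_cases h1 : lam = 1
  · subst h1
    have hc' : 1 + Real.cos (reduced t) ≠ 0 := by linarith
    simp [touches_one_iff, hc']
  exact touches_iff_of_ne h0 h1 t m

/-! ### Gluing functions over the sheets -/

theorem reduced_add (t : ℝ) : t = reduced t + sheet t * (4 * Real.pi / 3) := by
  unfold reduced; ring

theorem sheet_eq_of_mem {t : ℝ} {k : ℤ} (h₁ : -(2 * Real.pi / 3) ≤ t - k * (4 * Real.pi / 3))
    (h₂ : t - k * (4 * Real.pi / 3) < 2 * Real.pi / 3) : sheet t = k := by
  have hpi := Real.pi_pos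
  have h3 : 3 * t / (4 * Real.pi) * (4 * Real.pi / 3) = t := by field_simp
  unfold sheet
  rw [Int.floor_eq_iff]
  constructor <;> by_contra! h <;> nlinarith

theorem neg_lt_reduced {t : ℝ}
    (ht : ∀ j : ℤ, t ≠ 2 * Real.pi / 3 + j * (4 * Real.pi / 3)) :
    -(2 * Real.pi / 3) < reduced t := by
  refine lt_of_le_of_ne (reduced_mem t).1 fun h => ht (sheet t - 1) ?_
  have := reduced_add t
  rw [← h] at this
  push_cast
  linarith

theorem sheet_eventually_eq {t : ℝ}
    (ht : ∀ j : ℤ, t ≠ 2 * Real.pi / 3 + j * (4 * Real.pi / 3)) :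
    ∀ᶠ u in nhds t, sheet u = sheet t := by
  have h1 := neg_lt_reduced ht
  have h2 := (reduced_mem t).2
  have h3 := reduced_add t
  have : Set.Ioo (-(2 * Real.pi / 3) + sheet t * (4 * Real.pi / 3))
      (2 * Real.pi / 3 + sheet t * (4 * Real.pi / 3)) ∈ nhds t :=
    Ioo_mem_nhds (by linarith) (by linarith)
  filter_upwards [this] with u hu
  exact sheet_eq_of_mem (by linarith [hu.1]) (by linarith [hu.2])

/-- Off the turning points the sheet number is locally constant, so only a translation of the
argument is involved. -/
theorem hasDerivAt_sheet {F : ℤ → ℝ → ℝ} {t d : ℝ}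
    (ht : ∀ j : ℤ, t ≠ 2 * Real.pi / 3 + j * (4 * Real.pi / 3))
    (hF : HasDerivAt (F (sheet t)) d (reduced t)) :
    HasDerivAt (fun u => F (sheet u) (reduced u)) d t := by
  have h1 : HasDerivAt (fun u => F (sheet t) (u - sheet t * (4 * Real.pi / 3))) d t :=
    HasDerivAt.comp_sub_const t (sheet t * (4 * Real.pi / 3)) hF
  refine h1.congr_of_eventuallyEq ?_
  filter_upwards [sheet_eventually_eq ht] with u hu
  simp only [reduced, hu]

theorem continuous_sheet {F : ℤ → ℝ → ℝ}
    (hF : ∀ k, ContinuousOn (F k) (Set.Icc (-(2 * Real.pi / 3)) (2 * Real.pi / 3)))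
    (hglue : ∀ k, F (k + 1) (-(2 * Real.pi / 3)) = F k (2 * Real.pi / 3)) :
    Continuous fun t => F (sheet t) (reduced t) := by
  have hpi := Real.pi_pos
  have key : ∀ k : ℤ, ContinuousOn (fun t => F (sheet t) (reduced t))
      (Set.Icc (-(2 * Real.pi / 3) + k * (4 * Real.pi / 3))
        (2 * Real.pi / 3 + k * (4 * Real.pi / 3))) := by
    intro k
    have h1 : ContinuousOn (fun t : ℝ => F k (t - k * (4 * Real.pi / 3)))
        (Set.Icc (-(2 * Real.pi / 3) + k * (4 * Real.pi / 3))
          (2 * Real.pi / 3 + k * (4 * Real.pi / 3))) := by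
      refine (hF k).comp (by fun_prop) ?_
      rintro u ⟨h2, h3⟩
      exact ⟨by linarith, by linarith⟩
    refine h1.congr ?_
    rintro u ⟨h2, h3⟩
    rcases h3.lt_or_eq with h3 | h3
    · have hs : sheet u = k := sheet_eq_of_mem (by linarith) (by linarith)
      simp only [reduced, hs]
    -- Sheets are half-open, so the right endpoint counts as the left endpoint of the next sheet;
    -- the gluing condition is needed exactly here.
    · have hs : sheet u = k + 1 := by
        apply sheet_eq_of_mem <;> push_cast <;> linarith
      have e1 : u - ((k + 1 : ℤ) : ℝ) * (4 * Real.pi / 3) = -(2 * Real.pi / 3) := by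
        rw [h3]; push_cast; ring
      have e2 : u - (k : ℝ) * (4 * Real.pi / 3) = 2 * Real.pi / 3 := by rw [h3]; ring
      simp only [reduced, hs]
      rw [e1, e2, hglue]
  rw [continuous_iff_continuousAt]
  intro t
  have h1 := reduced_mem t
  have h3 := reduced_add t
  rcases h1.1.lt_or_eq with h | h
  · exact (key (sheet t)).continuousAt (Icc_mem_nhds (by linarith) (by linarith))
  · rw [continuousAt_iff_continuous_left_right]
    constructor
    · refine (key (sheet t - 1) t ?_).mono_of_mem_nhdsWithin (Icc_mem_nhdsLE_of_mem ?_)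
      · constructor <;> push_cast <;> linarith
      · constructor <;> push_cast <;> linarith
    · refine (key (sheet t) t ?_).mono_of_mem_nhdsWithin (Icc_mem_nhdsGE_of_mem ?_)
      · constructor <;> linarith
      · constructor <;> linarith

/-! ### The developed curves on the fundamental interval -/

/-- The angular term of the first coordinate. -/
def devArc (u : ℝ) : ℝ :=
  Real.sign u * Real.arccos (Real.sqrt 2 * Real.cos u / Real.sqrt (1 + Real.cos u))

/-- The first coordinate of the development of `k_A`. -/
def curveA1 (u : ℝ) : ℝ :=
  2 * Real.sqrt 3 / 9 * (devArc u + 2 * Real.sin (u / 2) * Real.sqrt (1 + 2 * Real.cos u))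

/-- The second coordinate of the development of `k_A`. -/
def curveA2 (u : ℝ) : ℝ :=
  Real.sqrt 3 / 9 * (Real.log (2 / (1 + Real.cos u)) + (4 - 4 * Real.cos u))

/-- The first coordinate of the development of `k_B`. -/
def curveB1 (u : ℝ) : ℝ :=
  2 * Real.sqrt 3 / 9 * (devArc u -
    Real.sin (u / 2) * Real.sqrt (1 + 2 * Real.cos u) / Real.cos (u / 2) ^ 2)

/-- The second coordinate of the development of `k_B`. -/
def curveB2 (u : ℝ) : ℝ :=
  Real.sqrt 3 / 9 * (Real.log (2 / (1 + Real.cos u)) +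
    (11 + 7 * Real.cos u) / (1 + Real.cos u))

/-- A continuous function whose derivative has a limit at a point is differentiable there with that
derivative, applied from each side. It serves `devArc` at 0, where the sign jumps and arccos is
evaluated at its singular point 1. -/
theorem hasDerivAt_of_hasDerivAt_of_ne_local {f g : ℝ → ℝ} {x : ℝ}
    (hd : ∀ᶠ y in nhds x, y ≠ x → HasDerivAt f (g y) y) (hf : ContinuousAt f x)
    (hg : ContinuousAt g x) : HasDerivAt f (g x) x := by
  have hd' : ∀ᶠ y in nhdsWithin x {x}ᶜ, HasDerivAt f (g y) y :=
    eventually_nhdsWithin_iff.2 hd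
  have A : HasDerivWithinAt f (g x) (Set.Ici x) x := by
    have hd2 : ∀ᶠ y in nhdsWithin x (Set.Ioi x), HasDerivAt f (g y) y :=
      hd'.filter_mono (nhdsWithin_mono _ fun y hy => ne_of_gt hy)
    refine hasDerivWithinAt_Ici_of_tendsto_deriv
      (s := {y | HasDerivAt f (g y) y} ∩ Set.Ioi x) ?_ hf.continuousWithinAt
      (Filter.inter_mem hd2 self_mem_nhdsWithin) ?_
    · exact fun y hy => (HasDerivAt.differentiableAt hy.1).differentiableWithinAt
    · refine (hg.tendsto.mono_left nhdsWithin_le_nhds).congr' ?_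
      filter_upwards [hd2] with y hy using hy.deriv.symm
  have B : HasDerivWithinAt f (g x) (Set.Iic x) x := by
    have hd2 : ∀ᶠ y in nhdsWithin x (Set.Iio x), HasDerivAt f (g y) y :=
      hd'.filter_mono (nhdsWithin_mono _ fun y hy => ne_of_lt hy)
    refine hasDerivWithinAt_Iic_of_tendsto_deriv
      (s := {y | HasDerivAt f (g y) y} ∩ Set.Iio x) ?_ hf.continuousWithinAt
      (Filter.inter_mem hd2 self_mem_nhdsWithin) ?_
    · exact fun y hy => (HasDerivAt.differentiableAt hy.1).differentiableWithinAt
    · refine (hg.tendsto.mono_left nhdsWithin_le_nhds).congr' ?_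
      filter_upwards [hd2] with y hy using hy.deriv.symm
  simpa using B.union A

theorem sign_eventually_eq {u : ℝ} (hu : u ≠ 0) : ∀ᶠ v in nhds u, Real.sign v = Real.sign u := by
  rcases hu.lt_or_gt with h | h
  · filter_upwards [Iio_mem_nhds h] with v hv
    rw [Real.sign_of_neg hv, Real.sign_of_neg h]
  · filter_upwards [Ioi_mem_nhds h] with v hv
    rw [Real.sign_of_pos hv, Real.sign_of_pos h]

/-- The jump of the sign at 0 is harmless because the other factor tends to 0 there. -/
theorem continuousOn_sign_mul {a : ℝ → ℝ} {s : Set ℝ} (ha : ContinuousOn a s) (h0 : a 0 = 0) :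
    ContinuousOn (fun u => Real.sign u * a u) s := by
  intro u hu
  by_cases hu0 : u = 0
  · subst hu0
    have h1 : Filter.Tendsto a (nhdsWithin 0 s) (nhds 0) := by
      have := ha 0 hu
      rwa [ContinuousWithinAt, h0] at this
    unfold ContinuousWithinAt
    simp only [h0, mul_zero]
    refine squeeze_zero_norm (a := fun u => ‖a u‖) (fun v => ?_) (by simpa using h1.norm)
    rw [norm_mul]
    refine mul_le_of_le_one_left (norm_nonneg _) ?_
    rcases Real.sign_apply_eq v with h | h | h <;> rw [h] <;> norm_num
  · refine ((continuousWithinAt_const (b := Real.sign u)).mul (ha u hu)).congr_of_eventuallyEq ?_ rfl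
    filter_upwards [nhdsWithin_le_nhds (sign_eventually_eq hu0)] with v hv
    simp only [Pi.mul_apply, hv]

theorem sqrt_one_add_cos {u : ℝ} (hq : 0 ≤ Real.cos (u / 2)) :
    Real.sqrt (1 + Real.cos u) = Real.sqrt 2 * Real.cos (u / 2) := by
  rw [cos_eq_half u]
  rw [show 1 + (2 * Real.cos (u / 2) ^ 2 - 1) = 2 * Real.cos (u / 2) ^ 2 by ring,
    Real.sqrt_mul (by norm_num), Real.sqrt_sq hq]

theorem devArc_eq {u : ℝ} (hq : 0 ≤ Real.cos (u / 2)) :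
    devArc u = Real.sign u * Real.arccos (Real.cos u / Real.cos (u / 2)) := by
  have h2 : Real.sqrt 2 ≠ 0 := by positivity
  rw [devArc, sqrt_one_add_cos hq, mul_div_mul_left _ _ h2]

theorem continuousOn_devArc :
    ContinuousOn devArc (Set.Icc (-(2 * Real.pi / 3)) (2 * Real.pi / 3)) := by
  refine ContinuousOn.congr (f := fun u => Real.sign u *
    Real.arccos (Real.cos u / Real.cos (u / 2))) ?_ ?_
  · refine continuousOn_sign_mul ?_ (by simp)
    refine Real.continuous_arccos.comp_continuousOn ?_
    refine ContinuousOn.div (by fun_prop) (by fun_prop) ?_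
    rintro u ⟨h1, h2⟩
    have := half_le_cos_half h1 h2
    positivity
  · rintro u ⟨h1, h2⟩
    have := half_le_cos_half h1 h2
    exact devArc_eq (by linarith)

theorem hasDerivAt_sin_half (u : ℝ) :
    HasDerivAt (fun v => Real.sin (v / 2)) (Real.cos (u / 2) / 2) u := by
  have := (((hasDerivAt_id u).div_const 2).sin)
  refine this.congr_deriv ?_
  simp; ring

theorem hasDerivAt_cos_half (u : ℝ) :
    HasDerivAt (fun v => Real.cos (v / 2)) (-Real.sin (u / 2) / 2) u := by
  have := (((hasDerivAt_id u).div_const 2).cos)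
  refine this.congr_deriv ?_
  simp; ring

/-- The algebraic relations between the half-angle functions and the square root. -/
theorem half_angle_relations {u : ℝ} (h₁ : -(2 * Real.pi / 3) ≤ u) (h₂ : u ≤ 2 * Real.pi / 3) :
    1 / 2 ≤ Real.cos (u / 2) ∧ Real.sin (u / 2) ^ 2 = 1 - Real.cos (u / 2) ^ 2 ∧
      Real.sqrt (1 + 2 * Real.cos u) ^ 2 = 4 * Real.cos (u / 2) ^ 2 - 1 := by
  refine ⟨half_le_cos_half h₁ h₂, ?_, ?_⟩
  · linarith [Real.sin_sq_add_cos_sq (u / 2)]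
  · rw [Real.sq_sqrt (by linarith [neg_half_le_cos h₁ h₂]), cos_eq_half u]; ring

theorem sqrt_pos_of_mem {u : ℝ} (h₁ : -(2 * Real.pi / 3) < u) (h₂ : u < 2 * Real.pi / 3) :
    0 < Real.sqrt (1 + 2 * Real.cos u) := by
  apply Real.sqrt_pos.2
  have := half_lt_cos_half h₁ h₂
  rw [cos_eq_half u]
  nlinarith

theorem hasDerivAt_sqrt_cos {u : ℝ} (h₁ : -(2 * Real.pi / 3) < u) (h₂ : u < 2 * Real.pi / 3) :
    HasDerivAt (fun v => Real.sqrt (1 + 2 * Real.cos v))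
      (-(2 * Real.sin (u / 2) * Real.cos (u / 2)) / Real.sqrt (1 + 2 * Real.cos u)) u := by
  have hr := sqrt_pos_of_mem h₁ h₂
  have := (((Real.hasDerivAt_cos u).const_mul 2).const_add 1).sqrt (Real.sqrt_pos.1 hr).ne'
  refine this.congr_deriv ?_
  rw [sin_eq_half u]
  field_simp

theorem hasDerivAt_devArc_of_ne {u : ℝ} (h₁ : -(2 * Real.pi / 3) < u) (h₂ : u < 2 * Real.pi / 3)
    (h0 : u ≠ 0) :
    HasDerivAt devArc ((2 * Real.cos (u / 2) ^ 2 + 1) /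
      (2 * Real.sqrt (1 + 2 * Real.cos u) * Real.cos (u / 2))) u := by
  obtain ⟨hq, hp, hr⟩ := half_angle_relations h₁.le h₂.le
  have hr0 := sqrt_pos_of_mem h₁ h₂
  have hpi := Real.pi_pos
  have hq0 : 0 < Real.cos (u / 2) := by linarith
  obtain ⟨hε, hεp⟩ : Real.sign u ^ 2 = 1 ∧ 0 < Real.sign u * Real.sin (u / 2) := by
    rcases h0.lt_or_gt with h | h
    · rw [Real.sign_of_neg h]
      have := Real.sin_neg_of_neg_of_neg_pi_lt (x := u / 2) (by linarith) (by linarith)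
      constructor <;> linarith
    · rw [Real.sign_of_pos h]
      have := Real.sin_pos_of_pos_of_lt_pi (x := u / 2) (by linarith) (by linarith)
      constructor <;> linarith
  -- The radicand in the derivative of arccos is a perfect square, since q² - (2q²-1)² =
  -- (1-q²)(4q²-1). The sign of u selects its positive root.
  have hx : 1 - (Real.cos u / Real.cos (u / 2)) ^ 2 =
      (Real.sign u * Real.sin (u / 2) * Real.sqrt (1 + 2 * Real.cos u) / Real.cos (u / 2)) ^ 2 := by
    rw [div_pow, div_pow, mul_pow, mul_pow, hε, hp, hr, cos_eq_half u]
    field_simp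
    ring
  have hpos : 0 < Real.sign u * Real.sin (u / 2) * Real.sqrt (1 + 2 * Real.cos u) /
      Real.cos (u / 2) := by positivity
  have hne1 : Real.cos u / Real.cos (u / 2) ≠ -1 := by
    intro h; rw [h] at hx; nlinarith
  have hne2 : Real.cos u / Real.cos (u / 2) ≠ 1 := by
    intro h; rw [h] at hx; nlinarith
  have hd := (((Real.hasDerivAt_arccos hne1 hne2).comp u
    ((Real.hasDerivAt_cos u).div (hasDerivAt_cos_half u) hq0.ne')).const_mul (Real.sign u))
  have heq : devArc =ᶠ[nhds u] fun v => Real.sign u *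
      (Real.arccos ∘ (Real.cos / fun v => Real.cos (v / 2))) v := by
    filter_upwards [sign_eventually_eq h0, Ioo_mem_nhds h₁ h₂] with v hv hv2
    rw [devArc_eq (by linarith [half_lt_cos_half hv2.1 hv2.2]), hv]
    rfl
  refine (hd.congr_of_eventuallyEq heq).congr_deriv ?_
  rw [hx, Real.sqrt_sq hpos.le, sin_eq_half u, cos_eq_half u]
  have e1 : Real.sign u ≠ 0 := by intro h; rw [h] at hεp; simp at hεp
  have e2 : Real.sin (u / 2) ≠ 0 := by intro h; rw [h] at hεp; simp at hεp
  rw [← cos_eq_half u]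
  have := hr0.ne'
  field_simp
  linarith [cos_eq_half u]

theorem hasDerivAt_devArc {u : ℝ} (h₁ : -(2 * Real.pi / 3) < u) (h₂ : u < 2 * Real.pi / 3) :
    HasDerivAt devArc ((2 * Real.cos (u / 2) ^ 2 + 1) /
      (2 * Real.sqrt (1 + 2 * Real.cos u) * Real.cos (u / 2))) u := by
  by_cases h0 : u = 0
  · subst h0
    refine hasDerivAt_of_hasDerivAt_of_ne_local (f := devArc)
      (g := fun u => (2 * Real.cos (u / 2) ^ 2 + 1) /
      (2 * Real.sqrt (1 + 2 * Real.cos u) * Real.cos (u / 2))) ?_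
      (continuousOn_devArc.continuousAt (Icc_mem_nhds h₁ h₂)) ?_
    · filter_upwards [Ioo_mem_nhds h₁ h₂] with v hv hv0
      exact hasDerivAt_devArc_of_ne hv.1 hv.2 hv0
    · have h1 := sqrt_pos_of_mem h₁ h₂
      have h2 := half_lt_cos_half h₁ h₂
      refine ContinuousAt.div (by fun_prop) (by fun_prop) ?_
      positivity
  · exact hasDerivAt_devArc_of_ne h₁ h₂ h0

theorem hasDerivAt_curveA1 {u : ℝ} (h₁ : -(2 * Real.pi / 3) < u) (h₂ : u < 2 * Real.pi / 3) :
    HasDerivAt curveA1 (Real.sqrt 3 / 9 * (Real.sqrt (1 + 2 * Real.cos u) ^ 3 /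
      Real.cos (u / 2))) u := by
  obtain ⟨hq, hp, hr⟩ := half_angle_relations h₁.le h₂.le
  have hr0 := (sqrt_pos_of_mem h₁ h₂).ne'
  have hq0 : Real.cos (u / 2) ≠ 0 := by linarith
  have := ((hasDerivAt_devArc h₁ h₂).add
    (((hasDerivAt_sin_half u).const_mul 2).mul (hasDerivAt_sqrt_cos h₁ h₂))).const_mul
    (2 * Real.sqrt 3 / 9)
  refine this.congr_deriv ?_
  generalize Real.sqrt (1 + 2 * Real.cos u) = r at *
  generalize Real.cos (u / 2) = q at *
  generalize Real.sin (u / 2) = p at *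
  have h4 : r ^ 4 = (4 * q ^ 2 - 1) ^ 2 := by rw [← hr]; ring
  field_simp
  rw [h4, hp, hr]
  ring

theorem hasDerivAt_log_cos {u : ℝ} (h₁ : -(2 * Real.pi / 3) < u) (h₂ : u < 2 * Real.pi / 3) :
    HasDerivAt (fun v => Real.log (2 / (1 + Real.cos v))) (Real.sin (u / 2) / Real.cos (u / 2))
      u := by
  have hc := neg_half_le_cos h₁.le h₂.le
  have hc0 : 1 + Real.cos u ≠ 0 := by linarith
  have hq := half_lt_cos_half h₁ h₂
  have := ((hasDerivAt_const u (2 : ℝ)).div ((Real.hasDerivAt_cos u).const_add 1) hc0).log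
    (div_ne_zero two_ne_zero hc0)
  refine this.congr_deriv ?_
  simp only [Pi.div_apply]
  have hq0 : Real.cos (u / 2) ≠ 0 := by linarith
  rw [sin_eq_half u, cos_eq_half u]
  field_simp
  ring

theorem hasDerivAt_curveA2 {u : ℝ} (h₁ : -(2 * Real.pi / 3) < u) (h₂ : u < 2 * Real.pi / 3) :
    HasDerivAt curveA2 (Real.sqrt 3 / 9 * (Real.sin (u / 2) * (1 + 8 * Real.cos (u / 2) ^ 2) /
      Real.cos (u / 2))) u := by
  have hq := half_lt_cos_half h₁ h₂
  have := ((hasDerivAt_log_cos h₁ h₂).add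
    (((Real.hasDerivAt_cos u).const_mul 4).const_sub 4)).const_mul (Real.sqrt 3 / 9)
  refine this.congr_deriv ?_
  have hq0 : Real.cos (u / 2) ≠ 0 := by linarith
  rw [sin_eq_half u]
  field_simp
  ring

/-- The factor r in the denominator vanishes at the turning points, so the open interval is
essential. -/
theorem hasDerivAt_curveB1 {u : ℝ} (h₁ : -(2 * Real.pi / 3) < u) (h₂ : u < 2 * Real.pi / 3) :
    HasDerivAt curveB1 (2 * Real.sqrt 3 / 9 * (Real.sin (u / 2) ^ 4 /
      (Real.sqrt (1 + 2 * Real.cos u) * Real.cos (u / 2) ^ 3))) u := by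
  obtain ⟨hq, hp, hr⟩ := half_angle_relations h₁.le h₂.le
  have hr0 := (sqrt_pos_of_mem h₁ h₂).ne'
  have hq0 : Real.cos (u / 2) ≠ 0 := by linarith
  have := ((hasDerivAt_devArc h₁ h₂).sub
    (((hasDerivAt_sin_half u).mul (hasDerivAt_sqrt_cos h₁ h₂)).div
      ((hasDerivAt_cos_half u).pow 2) (pow_ne_zero 2 hq0))).const_mul (2 * Real.sqrt 3 / 9)
  refine this.congr_deriv ?_
  simp only [Pi.mul_apply, Pi.pow_apply]
  generalize Real.sqrt (1 + 2 * Real.cos u) = r at *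
  generalize Real.cos (u / 2) = q at *
  generalize Real.sin (u / 2) = p at *
  have h4 : p ^ 4 = (1 - q ^ 2) ^ 2 := by rw [← hp]; ring
  rw [h4]
  push_cast
  field_simp
  rw [hp, hr]
  ring

theorem hasDerivAt_curveB2 {u : ℝ} (h₁ : -(2 * Real.pi / 3) < u) (h₂ : u < 2 * Real.pi / 3) :
    HasDerivAt curveB2 (Real.sqrt 3 / 9 * (Real.sin (u / 2) * (Real.cos (u / 2) ^ 2 + 2) /
      Real.cos (u / 2) ^ 3)) u := by
  have hc := neg_half_le_cos h₁.le h₂.le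
  have hc0 : 1 + Real.cos u ≠ 0 := by linarith
  have hq := half_lt_cos_half h₁ h₂
  have := ((hasDerivAt_log_cos h₁ h₂).add
    ((((Real.hasDerivAt_cos u).const_mul 7).const_add 11).div
      ((Real.hasDerivAt_cos u).const_add 1) hc0)).const_mul (Real.sqrt 3 / 9)
  refine this.congr_deriv ?_
  have hq0 : Real.cos (u / 2) ≠ 0 := by linarith
  rw [sin_eq_half u, cos_eq_half u]
  field_simp
  ring

/-! ### The explicit development -/

/-- The development of the point of `k_A`. -/
def devA (t : ℝ) : Fin 2 → ℝ :=
  ![sheet t * (4 * Real.pi / (3 * Real.sqrt 3)) + curveA1 (reduced t), curveA2 (reduced t)]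

/-- The development of the point of `k_B`. -/
def devB (t : ℝ) : Fin 2 → ℝ :=
  ![sheet t * (4 * Real.pi / (3 * Real.sqrt 3)) + curveB1 (reduced t), curveB2 (reduced t)]

/-- The explicit development of the extended oloid. -/
def dev (t m : ℝ) : Fin 2 → ℝ := (1 - m) • devA t + m • devB t

/-! ### Behaviour at the turning points and continuity across sheets -/

theorem cos_two_pi_div_three : Real.cos (2 * Real.pi / 3) = -(1 / 2) := by
  rw [cos_eq_half, show 2 * Real.pi / 3 / 2 = Real.pi / 3 by ring, Real.cos_pi_div_three]
  norm_num

theorem devArc_neg (u : ℝ) : devArc (-u) = -devArc u := by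
  simp [devArc, Real.sign_neg]

theorem devArc_two_pi_div_three : devArc (2 * Real.pi / 3) = Real.pi := by
  have hpi := Real.pi_pos
  have hq : Real.cos (2 * Real.pi / 3 / 2) = 1 / 2 := by
    rw [show 2 * Real.pi / 3 / 2 = Real.pi / 3 by ring, Real.cos_pi_div_three]
  rw [devArc_eq (by rw [hq]; norm_num), Real.sign_of_pos (by positivity), hq,
    cos_two_pi_div_three]
  norm_num

theorem sqrt_turning : Real.sqrt (1 + 2 * Real.cos (2 * Real.pi / 3)) = 0 := by
  rw [cos_two_pi_div_three]; norm_num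

theorem curveA1_neg (u : ℝ) : curveA1 (-u) = -curveA1 u := by
  simp only [curveA1, devArc_neg, neg_div, Real.sin_neg, Real.cos_neg]; ring

theorem curveB1_neg (u : ℝ) : curveB1 (-u) = -curveB1 u := by
  simp only [curveB1, devArc_neg, neg_div, Real.sin_neg, Real.cos_neg]; ring

theorem curveA2_neg (u : ℝ) : curveA2 (-u) = curveA2 u := by
  simp only [curveA2, Real.cos_neg]

theorem curveB2_neg (u : ℝ) : curveB2 (-u) = curveB2 u := by
  simp only [curveB2, Real.cos_neg]

theorem period_eq : 4 * Real.pi / (3 * Real.sqrt 3) = 2 * (2 * Real.sqrt 3 / 9 * Real.pi) := by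
  have h : Real.sqrt 3 ^ 2 = 3 := Real.sq_sqrt (by norm_num)
  have h0 : Real.sqrt 3 ≠ 0 := by positivity
  field_simp
  rw [h]; norm_num

/-- At the turning point r = 0 removes the algebraic term and arccos(-1) = π remains. By `period_eq`
this is half the translation between sheets, so the odd first coordinates fit together. -/
theorem curveA1_turning : curveA1 (2 * Real.pi / 3) = 2 * Real.sqrt 3 / 9 * Real.pi := by
  rw [curveA1, devArc_two_pi_div_three, sqrt_turning]; ring

theorem curveB1_turning : curveB1 (2 * Real.pi / 3) = 2 * Real.sqrt 3 / 9 * Real.pi := by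
  rw [curveB1, devArc_two_pi_div_three, sqrt_turning]; ring

theorem continuousOn_log_cos : ContinuousOn (fun u => Real.log (2 / (1 + Real.cos u)))
    (Set.Icc (-(2 * Real.pi / 3)) (2 * Real.pi / 3)) := by
  have h : ∀ u ∈ Set.Icc (-(2 * Real.pi / 3)) (2 * Real.pi / 3), 1 + Real.cos u ≠ 0 :=
    fun u hu => by linarith [neg_half_le_cos hu.1 hu.2]
  exact (ContinuousOn.div (by fun_prop) (by fun_prop) h).log
    fun u hu => div_ne_zero two_ne_zero (h u hu)

theorem continuous_devA : Continuous devA := by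
  refine continuous_pi fun i => ?_
  fin_cases i
  · refine continuous_sheet (F := fun k u => k * (4 * Real.pi / (3 * Real.sqrt 3)) + curveA1 u)
      (fun k => ?_) fun k => ?_
    · refine continuousOn_const.add (continuousOn_const.mul (continuousOn_devArc.add ?_))
      fun_prop
    · rw [curveA1_neg, curveA1_turning, period_eq]; push_cast; ring
  · refine continuous_sheet (F := fun _ u => curveA2 u) (fun k => ?_) fun k => curveA2_neg _
    exact continuousOn_const.mul (continuousOn_log_cos.add (by fun_prop))

theorem continuous_devB : Continuous devB := by
  refine continuous_pi fun i => ?_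
  fin_cases i
  · refine continuous_sheet (F := fun k u => k * (4 * Real.pi / (3 * Real.sqrt 3)) + curveB1 u)
      (fun k => ?_) fun k => ?_
    · refine continuousOn_const.add (continuousOn_const.mul (continuousOn_devArc.sub ?_))
      refine ContinuousOn.div (by fun_prop) (by fun_prop) fun u hu => ?_
      have := half_le_cos_half hu.1 hu.2
      positivity
    · rw [curveB1_neg, curveB1_turning, period_eq]; push_cast; ring
  · refine continuous_sheet (F := fun _ u => curveB2 u) (fun k => ?_) fun k => curveB2_neg _
    refine continuousOn_const.mul (continuousOn_log_cos.add ?_)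
    refine ContinuousOn.div (by fun_prop) (by fun_prop) fun u hu => ?_
    have := neg_half_le_cos hu.1 hu.2
    linarith

/-- The velocity of the development of `k_A` in terms of half-angle functions. -/
def velA (p q r : ℝ) : Fin 2 → ℝ :=
  ![Real.sqrt 3 / 9 * (r ^ 3 / q), Real.sqrt 3 / 9 * (p * (1 + 8 * q ^ 2) / q)]

/-- The velocity of the development of `k_B` in terms of half-angle functions. -/
def velB (p q r : ℝ) : Fin 2 → ℝ :=
  ![2 * Real.sqrt 3 / 9 * (p ^ 4 / (r * q ^ 3)), Real.sqrt 3 / 9 * (p * (q ^ 2 + 2) / q ^ 3)]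

theorem hasDerivAt_devA {t : ℝ}
    (ht : ∀ j : ℤ, t ≠ 2 * Real.pi / 3 + j * (4 * Real.pi / 3)) :
    HasDerivAt devA (velA (Real.sin (reduced t / 2)) (Real.cos (reduced t / 2))
      (Real.sqrt (1 + 2 * Real.cos (reduced t)))) t := by
  have h1 := neg_lt_reduced ht
  have h2 := (reduced_mem t).2
  rw [hasDerivAt_pi]
  intro i
  fin_cases i
  · exact hasDerivAt_sheet (F := fun k u => k * (4 * Real.pi / (3 * Real.sqrt 3)) + curveA1 u) ht
      ((hasDerivAt_curveA1 h1 h2).const_add _)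
  · exact hasDerivAt_sheet (F := fun _ u => curveA2 u) ht (hasDerivAt_curveA2 h1 h2)

theorem hasDerivAt_devB {t : ℝ}
    (ht : ∀ j : ℤ, t ≠ 2 * Real.pi / 3 + j * (4 * Real.pi / 3)) :
    HasDerivAt devB (velB (Real.sin (reduced t / 2)) (Real.cos (reduced t / 2))
      (Real.sqrt (1 + 2 * Real.cos (reduced t)))) t := by
  have h1 := neg_lt_reduced ht
  have h2 := (reduced_mem t).2
  rw [hasDerivAt_pi]
  intro i
  fin_cases i
  · exact hasDerivAt_sheet (F := fun k u => k * (4 * Real.pi / (3 * Real.sqrt 3)) + curveB1 u) ht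
      ((hasDerivAt_curveB1 h1 h2).const_add _)
  · exact hasDerivAt_sheet (F := fun _ u => curveB2 u) ht (hasDerivAt_curveB2 h1 h2)

theorem hasDerivAt_dev {t : ℝ} (m : ℝ)
    (ht : ∀ j : ℤ, t ≠ 2 * Real.pi / 3 + j * (4 * Real.pi / 3)) :
    HasDerivAt (fun u => dev u m) ((1 - m) • velA (Real.sin (reduced t / 2))
      (Real.cos (reduced t / 2)) (Real.sqrt (1 + 2 * Real.cos (reduced t))) +
      m • velB (Real.sin (reduced t / 2))
      (Real.cos (reduced t / 2)) (Real.sqrt (1 + 2 * Real.cos (reduced t)))) t :=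
  ((hasDerivAt_devA ht).const_smul (1 - m)).add ((hasDerivAt_devB ht).const_smul m)

/-- The velocity of the surface point in terms of half-angle functions. -/
def velSurface (σ p q r m : ℝ) : Fin 3 → ℝ :=
  ![(1 - m) * (σ * (2 * q ^ 2 - 1)), (1 - m) * (2 * p * q) + m * (p / (2 * q ^ 3)),
    m * -(σ * (2 * q ^ 2 - 1) * p / (2 * q ^ 3 * r))]

theorem hasDerivAt_surface {t : ℝ} (m : ℝ)
    (ht : ∀ j : ℤ, t ≠ 2 * Real.pi / 3 + j * (4 * Real.pi / 3)) :
    HasDerivAt (fun u => surface u m) (velSurface (sheetSign t) (Real.sin (reduced t / 2))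
      (Real.cos (reduced t / 2)) (Real.sqrt (1 + 2 * Real.cos (reduced t))) m) t := by
  have h1 := neg_lt_reduced ht
  have h2 := (reduced_mem t).2
  have hc := neg_half_le_cos_reduced t
  have hc0 : 1 + Real.cos (reduced t) ≠ 0 := by linarith
  have hq0 : Real.cos (reduced t / 2) ≠ 0 := by linarith [half_lt_cos_half h1 h2]
  have hr0 := (sqrt_pos_of_mem h1 h2).ne'
  have hr := (half_angle_relations h1.le h2.le).2.2
  have hd := (Real.hasDerivAt_cos (reduced t)).const_add 1
  rw [hasDerivAt_pi]
  intro i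
  simp only [surface_apply]
  fin_cases i
  · have := hasDerivAt_sheet (F := fun k u => (1 - m) * ((-1 : ℝ) ^ k * Real.sin u)) ht
      (((Real.hasDerivAt_sin (reduced t)).const_mul _).const_mul (1 - m))
    refine this.congr_deriv ?_
    rw [cos_eq_half (reduced t)]
    rfl
  · have := hasDerivAt_sheet (F := fun _ u => (1 - m) * (-1 / 2 - Real.cos u) +
        m * (1 / 2 - Real.cos u / (1 + Real.cos u))) ht
      ((((Real.hasDerivAt_cos (reduced t)).const_sub _).const_mul (1 - m)).add
        ((((Real.hasDerivAt_cos (reduced t)).div hd hc0).const_sub (1 / 2)).const_mul m))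
    refine this.congr_deriv ?_
    simp only [velSurface, Fin.mk_one, Matrix.cons_val]
    rw [cos_eq_half (reduced t), sin_eq_half (reduced t)]
    field_simp
    ring
  · have := hasDerivAt_sheet (F := fun k u => m * (-((-1 : ℝ) ^ k) *
        (Real.sqrt (1 + 2 * Real.cos u) / (1 + Real.cos u)))) ht
      ((((hasDerivAt_sqrt_cos h1 h2).div hd hc0).const_mul _).const_mul m)
    refine this.congr_deriv ?_
    simp only [velSurface, Fin.reduceFinMk, Matrix.cons_val]
    change m * (-sheetSign t * _) = _
    have e : 1 + Real.cos (reduced t) = 2 * Real.cos (reduced t / 2) ^ 2 := by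
      rw [cos_eq_half (reduced t)]; ring
    rw [e, sin_eq_half (reduced t)]
    generalize Real.sqrt (1 + 2 * Real.cos (reduced t)) = r at *
    generalize Real.cos (reduced t / 2) = q at *
    generalize Real.sin (reduced t / 2) = p at *
    field_simp
    rw [hr]
    ring

/-- The difference vector of the developed generating line. -/
def lineDev (p q r : ℝ) : Fin 2 → ℝ :=
  ![-(2 * Real.sqrt 3 / 9 * (p * r * (1 + 2 * q ^ 2) / q ^ 2)),
    Real.sqrt 3 / 9 * ((8 * q ^ 4 - q ^ 2 + 2) / q ^ 2)]

/-- The difference vector of the generating line. -/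
def lineSpace (σ p q r : ℝ) : Fin 3 → ℝ :=
  ![-(σ * (2 * p * q)), (4 * q ^ 4 - 2 * q ^ 2 + 1) / (2 * q ^ 2), -(σ * (r / (2 * q ^ 2)))]

/-- The unit normal of the tangent plane. -/
def normalSpace (σ p q r : ℝ) : Fin 3 → ℝ :=
  ![-σ * p, (2 * q ^ 2 - 1) / (2 * q), σ * (r / (2 * q))]

theorem devB_sub_devA (t : ℝ) : devB t - devA t = lineDev (Real.sin (reduced t / 2))
    (Real.cos (reduced t / 2)) (Real.sqrt (1 + 2 * Real.cos (reduced t))) := by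
  have hq0 : Real.cos (reduced t / 2) ≠ 0 := by
    linarith [half_le_cos_half (reduced_mem t).1 (reduced_mem t).2.le]
  ext i
  fin_cases i
  · simp only [devA, devB, lineDev, curveA1, curveB1, Fin.zero_eta, Matrix.cons_val,
      Pi.sub_apply]
    field_simp
    ring
  · simp only [devA, devB, lineDev, curveA2, curveB2, Fin.mk_one, Matrix.cons_val,
      Pi.sub_apply]
    have e : Real.cos (reduced t) = 2 * Real.cos (reduced t / 2) ^ 2 - 1 := cos_eq_half _
    have e2 : 1 + Real.cos (reduced t) = 2 * Real.cos (reduced t / 2) ^ 2 := by rw [e]; ring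
    rw [e2, e]
    field_simp
    ring

theorem pointB_sub_pointA (t : ℝ) : pointB t - pointA t = lineSpace (sheetSign t)
    (Real.sin (reduced t / 2)) (Real.cos (reduced t / 2))
    (Real.sqrt (1 + 2 * Real.cos (reduced t))) := by
  have hq0 : Real.cos (reduced t / 2) ≠ 0 := by
    linarith [half_le_cos_half (reduced_mem t).1 (reduced_mem t).2.le]
  have e : Real.cos (reduced t) = 2 * Real.cos (reduced t / 2) ^ 2 - 1 := cos_eq_half _
  have e2 : 1 + Real.cos (reduced t) = 2 * Real.cos (reduced t / 2) ^ 2 := by rw [e]; ring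
  ext i
  fin_cases i <;> simp only [pointA, pointB, lineSpace, Fin.zero_eta, Fin.mk_one,
    Fin.reduceFinMk, Matrix.cons_val, Pi.sub_apply]
  · rw [sin_eq_half]; ring
  · rw [e2, e]
    field_simp
    ring
  · rw [e2]
    ring

theorem dev_zero (t : ℝ) : dev t 0 = devA t := by simp [dev]

theorem dev_one (t : ℝ) : dev t 1 = devB t := by simp [dev]

/-! ### Inner products and signed areas in half-angle functions -/

section identities

variable {σ p q r : ℝ}

theorem lineDev_dot_self (hp : p ^ 2 = 1 - q ^ 2) (hr : r ^ 2 = 4 * q ^ 2 - 1) (hq : q ≠ 0) :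
    lineDev p q r ⬝ᵥ lineDev p q r = 3 := by
  have h3 : Real.sqrt 3 ^ 2 = 3 := Real.sq_sqrt (by norm_num)
  simp only [lineDev, dotProduct, Fin.sum_univ_two, Matrix.cons_val]
  generalize Real.sqrt 3 = w at *
  field_simp
  rw [h3, hp, hr]
  ring

theorem lineSpace_dot_self (hσ : σ ^ 2 = 1) (hp : p ^ 2 = 1 - q ^ 2)
    (hr : r ^ 2 = 4 * q ^ 2 - 1) (hq : q ≠ 0) :
    lineSpace σ p q r ⬝ᵥ lineSpace σ p q r = 3 := by
  simp only [lineSpace, dotProduct, Fin.sum_univ_three, Matrix.cons_val]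
  field_simp
  rw [hσ, hp, hr]
  ring

theorem vel_dot_line (m : ℝ) (hσ : σ ^ 2 = 1) (hp : p ^ 2 = 1 - q ^ 2)
    (hr : r ^ 2 = 4 * q ^ 2 - 1) (hq : q ≠ 0) (hr0 : r ≠ 0) :
    ((1 - m) • velA p q r + m • velB p q r) ⬝ᵥ lineDev p q r =
      velSurface σ p q r m ⬝ᵥ lineSpace σ p q r := by
  have h3 : Real.sqrt 3 ^ 2 = 3 := Real.sq_sqrt (by norm_num)
  simp only [velA, velB, lineDev, velSurface, lineSpace, dotProduct, Fin.sum_univ_two,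
    Fin.sum_univ_three, Matrix.cons_val, Pi.add_apply, Pi.smul_apply, smul_eq_mul]
  generalize Real.sqrt 3 = w at *
  field_simp
  grind

theorem vel_dot_vel (m : ℝ) (hσ : σ ^ 2 = 1) (hp : p ^ 2 = 1 - q ^ 2)
    (hr : r ^ 2 = 4 * q ^ 2 - 1) (hq : q ≠ 0) (hr0 : r ≠ 0) :
    ((1 - m) • velA p q r + m • velB p q r) ⬝ᵥ ((1 - m) • velA p q r + m • velB p q r) =
      velSurface σ p q r m ⬝ᵥ velSurface σ p q r m := by
  have h3 : Real.sqrt 3 ^ 2 = 3 := Real.sq_sqrt (by norm_num)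
  simp only [velA, velB, velSurface, dotProduct, Fin.sum_univ_two,
    Fin.sum_univ_three, Matrix.cons_val, Pi.add_apply, Pi.smul_apply, smul_eq_mul]
  generalize Real.sqrt 3 = w at *
  field_simp
  grind

theorem vel_cross_line (m : ℝ) (hσ : σ ^ 2 = 1) (hp : p ^ 2 = 1 - q ^ 2)
    (hr : r ^ 2 = 4 * q ^ 2 - 1) (hq : q ≠ 0) (hr0 : r ≠ 0) :
    ((1 - m) • velA p q r + m • velB p q r) 0 * lineDev p q r 1 -
      ((1 - m) • velA p q r + m • velB p q r) 1 * lineDev p q r 0 =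
      (velSurface σ p q r m ⨯₃ lineSpace σ p q r) ⬝ᵥ normalSpace σ p q r := by
  have h3 : Real.sqrt 3 ^ 2 = 3 := Real.sq_sqrt (by norm_num)
  simp only [velA, velB, lineDev, velSurface, lineSpace, normalSpace, cross_apply, dotProduct,
    Fin.sum_univ_three, Matrix.cons_val, Pi.add_apply, Pi.smul_apply, smul_eq_mul]
  generalize Real.sqrt 3 = w at *
  field_simp
  grind

end identities

/-! ### The explicit map is a development -/

/-- The unit normal along the generating line with index `t`. -/
def unitNormal (t : ℝ) : Fin 3 → ℝ :=
  normalSpace (sheetSign t) (Real.sin (reduced t / 2)) (Real.cos (reduced t / 2))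
    (Real.sqrt (1 + 2 * Real.cos (reduced t)))

theorem half_angle_reduced (t : ℝ) : 1 / 2 ≤ Real.cos (reduced t / 2) ∧
    Real.sin (reduced t / 2) ^ 2 = 1 - Real.cos (reduced t / 2) ^ 2 ∧
    Real.sqrt (1 + 2 * Real.cos (reduced t)) ^ 2 = 4 * Real.cos (reduced t / 2) ^ 2 - 1 :=
  half_angle_relations (reduced_mem t).1 (reduced_mem t).2.le

theorem cos_half_reduced_ne (t : ℝ) : Real.cos (reduced t / 2) ≠ 0 := by
  linarith [(half_angle_reduced t).1]

theorem unitNormal_eq (t : ℝ) :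
    unitNormal t = (-(2 * Real.cos (reduced t / 2))⁻¹) • normal t := by
  have hq := cos_half_reduced_ne t
  ext i
  fin_cases i <;> simp only [unitNormal, normalSpace, normal, Fin.zero_eta, Fin.mk_one,
    Fin.reduceFinMk, Matrix.cons_val, Pi.smul_apply, smul_eq_mul]
  · rw [sin_eq_half (reduced t)]; field_simp
  · rw [cos_eq_half (reduced t)]; field_simp
  · field_simp

theorem unitNormal_dot_self (t : ℝ) : unitNormal t ⬝ᵥ unitNormal t = 1 := by
  have hq := cos_half_reduced_ne t
  rw [unitNormal_eq, smul_dotProduct, dotProduct_smul, normal_dot_self, smul_eq_mul, smul_eq_mul,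
    cos_eq_half (reduced t)]
  field_simp
  ring

/-- At a turning point σ changes sign; so does sin(u/2), as u jumps between the two endpoints, while
the factor r of the third coordinate vanishes there. -/
theorem continuous_unitNormal : Continuous unitNormal := by
  have hq : ∀ u ∈ Set.Icc (-(2 * Real.pi / 3)) (2 * Real.pi / 3), 2 * Real.cos (u / 2) ≠ 0 :=
    fun u hu => by linarith [half_le_cos_half hu.1 hu.2]
  have hz : ∀ k : ℤ, (-1 : ℝ) ^ (k + 1) = -(-1) ^ k := fun k => by
    rw [zpow_add_one₀ (by norm_num)]; ring
  refine continuous_pi fun i => ?_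
  fin_cases i
  · refine continuous_sheet (F := fun k u => -(-1 : ℝ) ^ k * Real.sin (u / 2))
      (fun k => by fun_prop) fun k => ?_
    simp only [hz, neg_div, Real.sin_neg]; ring
  · refine continuous_sheet
      (F := fun _ u => (2 * Real.cos (u / 2) ^ 2 - 1) / (2 * Real.cos (u / 2)))
      (fun k => ContinuousOn.div (by fun_prop) (by fun_prop) hq) fun k => ?_
    simp only [neg_div, Real.cos_neg]
  · refine continuous_sheet (F := fun k u => (-1 : ℝ) ^ k *
      (Real.sqrt (1 + 2 * Real.cos u) / (2 * Real.cos (u / 2))))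
      (fun k => continuousOn_const.mul (ContinuousOn.div (by fun_prop) (by fun_prop) hq))
      fun k => ?_
    simp only [Real.cos_neg, sqrt_turning, zero_div, mul_zero]

/-! ### Normalization along the line t = 0 -/

theorem sheet_zero : sheet 0 = 0 := by
  have hpi := Real.pi_pos
  apply sheet_eq_of_mem <;> norm_num <;> positivity

theorem reduced_zero : reduced 0 = 0 := by simp [reduced, sheet_zero]

theorem sheetSign_zero : sheetSign 0 = 1 := by simp [sheetSign, sheet_zero]

theorem sqrt_one_add_two : Real.sqrt (1 + 2) = Real.sqrt 3 := by norm_num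

theorem axisEta_eq : axisEta = ![0, Real.sqrt 3 / 2, -(1 / 2)] := by
  have h : Real.sqrt 3 ^ 2 = 3 := Real.sq_sqrt (by norm_num)
  have h0 : Real.sqrt 3 ≠ 0 := by positivity
  ext i
  fin_cases i <;> simp [axisEta, pointA, pointB, reduced_zero, sheetSign_zero, sqrt_one_add_two]
  · field_simp
    linarith
  · field_simp
    norm_num

theorem unitNormal_zero : unitNormal 0 = axisXi ⨯₃ axisEta := by
  rw [axisEta_eq, axisXi, cross_apply]
  ext i
  fin_cases i <;>
    simp [unitNormal, normalSpace, reduced_zero, sheetSign_zero, sqrt_one_add_two]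
  norm_num

theorem dev_fixed (m : ℝ) : planeE (dev 0 m) = surface 0 m := by
  have h : Real.sqrt 3 ^ 2 = 3 := Real.sq_sqrt (by norm_num)
  have hA : devA 0 = 0 := by
    ext i
    fin_cases i <;> simp [devA, curveA1, curveA2, devArc, sheet_zero, reduced_zero]
    norm_num
  have hB : devB 0 = ![0, Real.sqrt 3] := by
    ext i
    fin_cases i <;> simp [devB, curveB1, curveB2, devArc, sheet_zero, reduced_zero]
    norm_num
  rw [planeE, dev, hA, hB, surface_apply, axisEta_eq, axisXi]
  ext i
  fin_cases i <;>
    simp [pointA, reduced_zero, sheetSign_zero, sqrt_one_add_two]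
  · linear_combination (m / 2) * h
  · ring

theorem isDevelopment_dev : IsDevelopment dev where
  continuous := by
    have h1 : Continuous fun x : ℝ × ℝ => devA x.1 := continuous_devA.comp continuous_fst
    have h2 : Continuous fun x : ℝ × ℝ => devB x.1 := continuous_devB.comp continuous_fst
    unfold dev
    fun_prop
  ruled t m := by rw [dev_zero, dev_one]; rfl
  fixed := dev_fixed
  differentiable t m ht := (hasDerivAt_dev m ht).differentiableAt
  isometric_mm t := by
    obtain ⟨-, hp, hr⟩ := half_angle_reduced t
    rw [dev_zero, dev_one, devB_sub_devA, pointB_sub_pointA,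
      lineDev_dot_self hp hr (cos_half_reduced_ne t),
      lineSpace_dot_self (sheetSign_sq t) hp hr (cos_half_reduced_ne t)]
  isometric_tm t m ht := by
    obtain ⟨-, hp, hr⟩ := half_angle_reduced t
    rw [dev_zero, dev_one, devB_sub_devA, pointB_sub_pointA, (hasDerivAt_dev m ht).deriv,
      (hasDerivAt_surface m ht).deriv]
    exact vel_dot_line m (sheetSign_sq t) hp hr (cos_half_reduced_ne t)
      (sqrt_pos_of_mem (neg_lt_reduced ht) (reduced_mem t).2).ne'
  isometric_tt t m ht := by
    obtain ⟨-, hp, hr⟩ := half_angle_reduced t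
    rw [(hasDerivAt_dev m ht).deriv, (hasDerivAt_surface m ht).deriv]
    exact vel_dot_vel m (sheetSign_sq t) hp hr (cos_half_reduced_ne t)
      (sqrt_pos_of_mem (neg_lt_reduced ht) (reduced_mem t).2).ne'
  oriented := by
    refine ⟨unitNormal, continuous_unitNormal, unitNormal_zero, fun t => ⟨unitNormal_dot_self t,
      fun v hv => ?_⟩, fun t m ht => ?_⟩
    · rw [unitNormal_eq, smul_dotProduct, normal_dot_of_mem hv, smul_zero]
    · obtain ⟨-, hp, hr⟩ := half_angle_reduced t
      rw [dev_zero, dev_one, devB_sub_devA, pointB_sub_pointA, (hasDerivAt_dev m ht).deriv,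
        (hasDerivAt_surface m ht).deriv]
      exact vel_cross_line m (sheetSign_sq t) hp hr (cos_half_reduced_ne t)
        (sqrt_pos_of_mem (neg_lt_reduced ht) (reduced_mem t).2).ne'

/-! ### Uniqueness of the development -/

/-- Both fields are multiples of the same normal and have unit length, so their inner product is ±1
everywhere. By connectedness it keeps its initial value 1. -/
theorem unit_normal_unique {N₁ N₂ : ℝ → Fin 3 → ℝ} (h₁ : Continuous N₁) (h₂ : Continuous N₂)
    (h0 : N₁ 0 = N₂ 0)
    (hN₁ : ∀ t, N₁ t ⬝ᵥ N₁ t = 1 ∧ ∀ v ∈ tangentDir t, N₁ t ⬝ᵥ v = 0)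
    (hN₂ : ∀ t, N₂ t ⬝ᵥ N₂ t = 1 ∧ ∀ v ∈ tangentDir t, N₂ t ⬝ᵥ v = 0) : N₁ = N₂ := by
  have hc : Continuous fun t => N₁ t ⬝ᵥ N₂ t := h₁.dotProduct h₂
  have hsq : ∀ t, (N₁ t ⬝ᵥ N₂ t) ^ 2 = 1 := by
    intro t
    obtain ⟨a, ha⟩ := exists_smul_of_orthogonal (n := N₁ t) (g := normal t)
      fun v hv => (hN₁ t).2 v (mem_tangentDir_of_normal_dot hv)
    obtain ⟨b, hb⟩ := exists_smul_of_orthogonal (n := N₂ t) (g := normal t)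
      fun v hv => (hN₂ t).2 v (mem_tangentDir_of_normal_dot hv)
    have e1 := (hN₁ t).1
    have e2 := (hN₂ t).1
    rw [ha, smul_dotProduct, dotProduct_smul, smul_eq_mul, smul_eq_mul] at e1
    rw [hb, smul_dotProduct, dotProduct_smul, smul_eq_mul, smul_eq_mul] at e2
    rw [ha, hb, smul_dotProduct, dotProduct_smul, smul_eq_mul, smul_eq_mul]
    linear_combination (b * (b * (normal t ⬝ᵥ normal t))) * e1 + e2
  have h1 : ∀ t, N₁ t ⬝ᵥ N₂ t = 1 := by
    rcases isPreconnected_univ.eq_or_eq_neg_of_sq_eq (f := fun t => N₁ t ⬝ᵥ N₂ t)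
      (g := fun _ => (1 : ℝ)) hc.continuousOn continuousOn_const
      (fun t _ => by simp [hsq]) (fun _ => one_ne_zero) with h | h
    · exact fun t => h (Set.mem_univ t)
    · have := h (Set.mem_univ 0)
      simp only [h0, (hN₂ 0).1, Pi.neg_apply] at this
      norm_num at this
  ext1 t
  have : (N₁ t - N₂ t) ⬝ᵥ (N₁ t - N₂ t) = 0 := by
    rw [sub_dotProduct, dotProduct_sub, dotProduct_sub, dotProduct_comm (N₂ t) (N₁ t), h1,
      (hN₁ t).1, (hN₂ t).1]
    ring
  exact sub_eq_zero.1 (dotProduct_self_eq_zero.1 this)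

/-- The turning points form a countable set, which the fundamental theorem of calculus for
continuous functions tolerates. -/
theorem eq_of_hasDerivAt_zero {F : ℝ → ℝ} (hF : Continuous F)
    (hd : ∀ t, (∀ j : ℤ, t ≠ 2 * Real.pi / 3 + j * (4 * Real.pi / 3)) → HasDerivAt F 0 t)
    (t : ℝ) : F t = F 0 := by
  have h := MeasureTheory.integral_eq_of_hasDerivAt_off_countable F (fun _ => 0) (a := 0)
    (b := t) (Set.countable_range fun j : ℤ => 2 * Real.pi / 3 + j * (4 * Real.pi / 3))
    hF.continuousOn (fun x hx => hd x fun j hj => hx.2 ⟨j, hj.symm⟩) (by simp)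
  simp at h
  linarith

theorem IsDevelopment.continuous_apply {D : ℝ → ℝ → Fin 2 → ℝ} (hD : IsDevelopment D) (m : ℝ)
    (i : Fin 2) : Continuous fun t => D t m i :=
  (_root_.continuous_apply i).comp (hD.continuous.comp (Continuous.prodMk_left m))

theorem IsDevelopment.hasDerivAt_apply {D : ℝ → ℝ → Fin 2 → ℝ} (hD : IsDevelopment D) (m : ℝ)
    (i : Fin 2) {t : ℝ} (ht : ∀ j : ℤ, t ≠ 2 * Real.pi / 3 + j * (4 * Real.pi / 3)) :
    HasDerivAt (fun u => D u m i) (deriv (fun u => D u m) t i) t :=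
  hasDerivAt_pi.1 (hD.differentiable t m ht).hasDerivAt i

theorem planeE_injective : Function.Injective planeE := by
  intro x y hxy
  have h0 := congrFun hxy 0
  have h2 := congrFun hxy 2
  simp [planeE, axisXi, axisEta_eq] at h0 h2
  ext i
  fin_cases i
  · exact h0
  · exact h2

theorem IsDevelopment.line_sq {D : ℝ → ℝ → Fin 2 → ℝ} (hD : IsDevelopment D) (t : ℝ) :
    (D t 1 0 - D t 0 0) ^ 2 + (D t 1 1 - D t 0 1) ^ 2 = 3 := by
  obtain ⟨-, hp, hr⟩ := half_angle_reduced t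
  have := hD.isometric_mm t
  rw [pointB_sub_pointA, lineSpace_dot_self (sheetSign_sq t) hp hr (cos_half_reduced_ne t)] at this
  simp only [dotProduct, Fin.sum_univ_two, Pi.sub_apply] at this
  linarith

/-- Write L₁, L₂ for the two developed segments AB. Both rotate with the same angular speed, so
L₁·L₂ is constant; it starts at 3 = |L₁|² = |L₂|², which forces L₁ = L₂. -/
theorem IsDevelopment.line_eq {D₁ D₂ : ℝ → ℝ → Fin 2 → ℝ} (h₁ : IsDevelopment D₁)
    (h₂ : IsDevelopment D₂) (t : ℝ) :
    D₁ t 1 0 - D₁ t 0 0 = D₂ t 1 0 - D₂ t 0 0 ∧ D₁ t 1 1 - D₁ t 0 1 = D₂ t 1 1 - D₂ t 0 1 := by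
  have hzero (m : ℝ) : D₁ 0 m = D₂ 0 m :=
    planeE_injective ((h₁.fixed m).trans (h₂.fixed m).symm)
  have hX : (D₁ t 1 0 - D₁ t 0 0) * (D₂ t 1 0 - D₂ t 0 0) +
      (D₁ t 1 1 - D₁ t 0 1) * (D₂ t 1 1 - D₂ t 0 1) = 3 := by
    rw [eq_of_hasDerivAt_zero (F := fun t => (D₁ t 1 0 - D₁ t 0 0) * (D₂ t 1 0 - D₂ t 0 0) +
      (D₁ t 1 1 - D₁ t 0 1) * (D₂ t 1 1 - D₂ t 0 1)) ?_ ?_ t]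
    · simp only [hzero]
      linarith [h₂.line_sq 0]
    · have := h₁.continuous_apply
      have := h₂.continuous_apply
      fun_prop
    · intro t ht
      obtain ⟨N₁, hc₁, h0₁, hN₁, hor₁⟩ := h₁.oriented
      obtain ⟨N₂, hc₂, h0₂, hN₂, hor₂⟩ := h₂.oriented
      obtain rfl := unit_normal_unique hc₁ hc₂ (h0₁.trans h0₂.symm) hN₁ hN₂
      have hd (m : ℝ) (i : Fin 2) := h₁.hasDerivAt_apply m i ht
      have hd' (m : ℝ) (i : Fin 2) := h₂.hasDerivAt_apply m i ht
      have hor (m : ℝ) := (hor₁ t m ht).trans (hor₂ t m ht).symm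
      have a0 := hor 0
      have a1 := hor 1
      have s1 := h₁.line_sq t
      have s2 := h₂.line_sq t
      -- Differentiating the constant squared length shows that each segment is orthogonal to its
      -- derivative.
      have p1 := ((((hd 1 0).sub (hd 0 0)).pow 2).add (((hd 1 1).sub (hd 0 1)).pow 2)).unique
        ((hasDerivAt_const t (3 : ℝ)).congr_of_eventuallyEq
          (Filter.Eventually.of_forall h₁.line_sq))
      have p2 := ((((hd' 1 0).sub (hd' 0 0)).pow 2).add (((hd' 1 1).sub (hd' 0 1)).pow 2)).unique
        ((hasDerivAt_const t (3 : ℝ)).congr_of_eventuallyEq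
          (Filter.Eventually.of_forall h₂.line_sq))
      refine ((((hd 1 0).sub (hd 0 0)).mul ((hd' 1 0).sub (hd' 0 0))).add
        (((hd 1 1).sub (hd 0 1)).mul ((hd' 1 1).sub (hd' 0 1)))).congr_deriv ?_
      simp only [Pi.sub_apply] at p1 p2 a0 a1 ⊢
      norm_num at p1 p2
      generalize D₁ t 1 0 - D₁ t 0 0 = x at *
      generalize D₁ t 1 1 - D₁ t 0 1 = y at *
      generalize D₂ t 1 0 - D₂ t 0 0 = x' at *
      generalize D₂ t 1 1 - D₂ t 0 1 = y' at *
      generalize hu : deriv (fun u => D₁ u 1) t 0 - deriv (fun u => D₁ u 0) t 0 = u at *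
      generalize hv : deriv (fun u => D₁ u 1) t 1 - deriv (fun u => D₁ u 0) t 1 = v at *
      generalize hu' : deriv (fun u => D₂ u 1) t 0 - deriv (fun u => D₂ u 0) t 0 = u' at *
      generalize hv' : deriv (fun u => D₂ u 1) t 1 - deriv (fun u => D₂ u 0) t 1 = v' at *
      -- The difference of the area conditions at m = 1 and m = 0 is the cross product of the
      -- derivative of the segment with the segment, that is, its angular speed up to a constant
      -- factor.
      have q' : u * y - v * x = u' * y' - v' * x' := by
        rw [← hu, ← hv, ← hu', ← hv']
        linear_combination a1 - a0
      grind
  have s1 := h₁.line_sq t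
  have s2 := h₂.line_sq t
  generalize D₁ t 1 0 - D₁ t 0 0 = x at *
  generalize D₁ t 1 1 - D₁ t 0 1 = y at *
  generalize D₂ t 1 0 - D₂ t 0 0 = x' at *
  generalize D₂ t 1 1 - D₂ t 0 1 = y' at *
  have h : (x - x') ^ 2 + (y - y') ^ 2 = 0 := by linarith
  constructor <;> nlinarith [sq_nonneg (x - x'), sq_nonneg (y - y')]

theorem IsDevelopment.unique {D₁ D₂ : ℝ → ℝ → Fin 2 → ℝ} (h₁ : IsDevelopment D₁)
    (h₂ : IsDevelopment D₂) : D₁ = D₂ := by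
  have hzero (m : ℝ) : D₁ 0 m = D₂ 0 m :=
    planeE_injective ((h₁.fixed m).trans (h₂.fixed m).symm)
  have hderiv : ∀ t, (∀ j : ℤ, t ≠ 2 * Real.pi / 3 + j * (4 * Real.pi / 3)) → ∀ i,
      deriv (fun u => D₁ u 0) t i = deriv (fun u => D₂ u 0) t i := by
    intro t ht
    obtain ⟨N₁, hc₁, h0₁, hN₁, hor₁⟩ := h₁.oriented
    obtain ⟨N₂, hc₂, h0₂, hN₂, hor₂⟩ := h₂.oriented
    obtain rfl := unit_normal_unique hc₁ hc₂ (h0₁.trans h0₂.symm) hN₁ hN₂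
    have a := (hor₁ t 0 ht).trans (hor₂ t 0 ht).symm
    have b := (h₁.isometric_tm t 0 ht).trans (h₂.isometric_tm t 0 ht).symm
    have s := h₂.line_sq t
    have e := h₁.line_eq h₂ t
    simp only [dotProduct, Fin.sum_univ_two, Pi.sub_apply, e] at a b
    generalize D₂ t 1 0 - D₂ t 0 0 = x at *
    generalize D₂ t 1 1 - D₂ t 0 1 = y at *
    intro i
    fin_cases i
    · simp only [Fin.zero_eta]
      -- The difference of the two velocities has zero inner product and zero cross product with a
      -- vector of squared length 3; this solves the resulting linear system.
      linear_combination (x * b + y * a) / 3 - (deriv (fun u => D₁ u 0) t 0 -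
        deriv (fun u => D₂ u 0) t 0) * s / 3
    · simp only [Fin.mk_one]
      linear_combination (y * b - x * a) / 3 - (deriv (fun u => D₁ u 0) t 1 -
        deriv (fun u => D₂ u 0) t 1) * s / 3
  have hA : ∀ t, D₁ t 0 = D₂ t 0 := by
    intro t
    ext i
    have := eq_of_hasDerivAt_zero (F := fun t => D₁ t 0 i - D₂ t 0 i)
      ((h₁.continuous_apply 0 i).sub (h₂.continuous_apply 0 i)) (fun t ht =>
        ((h₁.hasDerivAt_apply 0 i ht).sub (h₂.hasDerivAt_apply 0 i ht)).congr_deriv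
          (by rw [hderiv t ht i, sub_self])) t
    simp only [hzero, sub_self] at this
    linarith
  have hB : ∀ t, D₁ t 1 = D₂ t 1 := by
    intro t
    have e := h₁.line_eq h₂ t
    rw [hA t] at e
    ext i
    fin_cases i
    · exact sub_left_injective e.1
    · exact sub_left_injective e.2
  ext1 t
  ext1 m
  rw [h₁.ruled, h₂.ruled, hA, hB]

/-! ### The touching curves in the development -/

/-- Rounding |t| and restoring the sign differs from rounding t only at negative turning points,
where the floor assigns the point to the other adjacent sheet. The exceptional case is harmless
because the developed curves agree at both ends. -/
theorem step_and_h (t : ℝ) :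
    (Real.sign t * step t = sheet t ∧ h t = reduced t) ∨
      (Real.sign t * step t = sheet t - 1 ∧ reduced t = -(2 * Real.pi / 3) ∧
        h t = 2 * Real.pi / 3) := by
  have hpi := Real.pi_pos
  rcases lt_trichotomy t 0 with ht | rfl | ht
  · have e : 3 * |t| / (4 * Real.pi) + 1 / 2 = -(3 * t / (4 * Real.pi) + 1 / 2) + 1 := by
      rw [abs_of_neg ht]; ring
    have hs : step t = -⌈3 * t / (4 * Real.pi) + 1 / 2⌉ + 1 := by
      rw [step, e, Int.floor_add_one, Int.floor_neg]; push_cast; ring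
    rw [h, Real.sign_of_neg ht, hs]
    by_cases hi : (sheet t : ℝ) = 3 * t / (4 * Real.pi) + 1 / 2
    · right
      rw [← hi, Int.ceil_intCast]
      have hr : reduced t = -(2 * Real.pi / 3) := by
        rw [reduced, hi]; field_simp; ring
      have := reduced_add t
      refine ⟨by ring, hr, ?_⟩
      rw [hr] at this
      linarith
    · left
      have hc : ⌈3 * t / (4 * Real.pi) + 1 / 2⌉ = sheet t + 1 := by
        rw [Int.ceil_eq_iff]
        have h1 := Int.floor_le (3 * t / (4 * Real.pi) + 1 / 2)
        have h2 := Int.lt_floor_add_one (3 * t / (4 * Real.pi) + 1 / 2)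
        push_cast
        refine ⟨?_, h2.le⟩
        rw [add_sub_cancel_right]
        exact lt_of_le_of_ne h1 hi
      rw [hc, reduced]
      push_cast
      constructor <;> ring
  · left
    simp [h, sheet_zero, reduced_zero]
  · left
    rw [h, Real.sign_of_pos ht, step, abs_of_pos ht, reduced, sheet, one_mul]
    exact ⟨rfl, rfl⟩

theorem cos_h (t : ℝ) : Real.cos (h t) = Real.cos (reduced t) := by
  rcases step_and_h t with ⟨-, e⟩ | ⟨-, e, e'⟩
  · rw [e]
  · rw [e, e', Real.cos_neg]

theorem sign_mul_abs_sin {u : ℝ} (h₁ : -Real.pi ≤ u) (h₂ : u ≤ Real.pi) :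
    Real.sign u * |Real.sin u| = Real.sin u := by
  rcases lt_trichotomy u 0 with h | rfl | h
  · rw [Real.sign_of_neg h, abs_of_nonpos (Real.sin_nonpos_of_nonpos_of_neg_pi_le h.le h₁)]; ring
  · simp
  · rw [Real.sign_of_pos h, abs_of_nonneg (Real.sin_nonneg_of_nonneg_of_le_pi h.le h₂), one_mul]

/-- The weight of A is (1-λ)/(1+λc). The angular term is the same in both curves and the weights add
up to 1, so only the algebraic terms have to be combined. -/
theorem sign_mul_kappaTilde1 {lam u : ℝ} (h₁ : -(2 * Real.pi / 3) ≤ u)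
    (h₂ : u ≤ 2 * Real.pi / 3) (hl : 1 + lam * Real.cos u ≠ 0) :
    Real.sign u * kappaTilde1 lam u =
      (1 - lam * (1 + Real.cos u) / (1 + lam * Real.cos u)) * curveA1 u +
        lam * (1 + Real.cos u) / (1 + lam * Real.cos u) * curveB1 u := by
  have hpi := Real.pi_pos
  obtain ⟨hq, hp, hr⟩ := half_angle_relations h₁ h₂
  have hq0 : Real.cos (u / 2) ≠ 0 := by linarith
  have hs := sign_mul_abs_sin (u := u) (by linarith) (by linarith)
  have h2 : Real.sqrt 2 ≠ 0 := by positivity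
  have e : 1 + Real.cos u = 2 * Real.cos (u / 2) ^ 2 := by rw [cos_eq_half u]; ring
  have hk : Real.sign u * kappaTilde1 lam u = 2 * Real.sqrt 3 / 9 * (devArc u +
      (1 - 2 * lam) * (Real.sign u * |Real.sin u|) * Real.sqrt (2 * (1 + 2 * Real.cos u)) /
        ((1 + lam * Real.cos u) * Real.sqrt (1 + Real.cos u))) := by
    rw [kappaTilde1, devArc]; ring
  rw [hk, hs, sqrt_one_add_cos (by linarith), Real.sqrt_mul (by norm_num), curveA1, curveB1,
    sin_eq_half u, e]
  have e' : Real.cos u = 2 * Real.cos (u / 2) ^ 2 - 1 := cos_eq_half u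
  generalize Real.sqrt (1 + 2 * Real.cos u) = r at *
  generalize Real.cos u = c at *
  generalize Real.cos (u / 2) = q at *
  have hl' : 1 + c * lam ≠ 0 := by rwa [mul_comm c]
  field_simp
  rw [e']
  ring

theorem kappaTilde2_eq {lam u : ℝ} (h₁ : -(2 * Real.pi / 3) ≤ u)
    (h₂ : u ≤ 2 * Real.pi / 3) (hl : 1 + lam * Real.cos u ≠ 0) :
    kappaTilde2 lam u =
      (1 - lam * (1 + Real.cos u) / (1 + lam * Real.cos u)) * curveA2 u +
        lam * (1 + Real.cos u) / (1 + lam * Real.cos u) * curveB2 u := by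
  have hc : 1 + Real.cos u ≠ 0 := by linarith [neg_half_le_cos h₁ h₂]
  rw [kappaTilde2, curveA2, curveB2]
  generalize Real.log (2 / (1 + Real.cos u)) = L at *
  generalize Real.cos u = c at *
  have hl' : 1 + c * lam ≠ 0 := by rwa [mul_comm c]
  field_simp
  ring

theorem kappaStar_eq_dev {lam t : ℝ} (hl : 1 + lam * Real.cos (reduced t) ≠ 0) :
    kappaStar lam t =
      dev t (lam * (1 + Real.cos (reduced t)) / (1 + lam * Real.cos (reduced t))) := by
  have hpi := Real.pi_pos
  have hm := reduced_mem t
  have hl2 : 1 + lam * Real.cos (h t) ≠ 0 := by rwa [cos_h]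
  obtain ⟨k1, k2⟩ : -(2 * Real.pi / 3) ≤ h t ∧ h t ≤ 2 * Real.pi / 3 := by
    rcases step_and_h t with ⟨-, e⟩ | ⟨-, -, e⟩
    · rw [e]; exact ⟨hm.1, hm.2.le⟩
    · rw [e]; constructor <;> linarith
  have g1 : Real.sign t * step t * (4 * Real.pi / (3 * Real.sqrt 3)) + curveA1 (h t) =
      devA t 0 ∧ Real.sign t * step t * (4 * Real.pi / (3 * Real.sqrt 3)) + curveB1 (h t) =
      devB t 0 ∧ curveA2 (h t) = devA t 1 ∧ curveB2 (h t) = devB t 1 := by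
    simp only [devA, devB, Matrix.cons_val]
    rcases step_and_h t with ⟨e1, e2⟩ | ⟨e1, e2, e3⟩
    · rw [e1, e2]
      exact ⟨rfl, rfl, rfl, rfl⟩
    · rw [e1, e2, e3, curveA1_neg, curveB1_neg, curveA2_neg, curveB2_neg, curveA1_turning,
        curveB1_turning, period_eq]
      refine ⟨by ring, by ring, rfl, rfl⟩
  obtain ⟨gA, gB, gA2, gB2⟩ := g1
  ext i
  fin_cases i
  · simp only [kappaStar, dev, Fin.zero_eta, Matrix.cons_val, Pi.add_apply, Pi.smul_apply,
      smul_eq_mul]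
    rw [sign_mul_kappaTilde1 k1 k2 hl2, ← gA, ← gB, cos_h]
    ring
  · simp only [kappaStar, dev, Fin.mk_one, Matrix.cons_val, Pi.add_apply, Pi.smul_apply,
      smul_eq_mul]
    rw [kappaTilde2_eq k1 k2 hl2, ← gA2, ← gB2, cos_h]

end Oloid

end

/-! ### Conclusion -/

theorem mainTheorem6 :
    (∃ D : ℝ → ℝ → Fin 2 → ℝ, Oloid.IsDevelopment D) ∧
    ∀ D : ℝ → ℝ → Fin 2 → ℝ, Oloid.IsDevelopment D → ∀ lam : ℝ,
      (∀ (t : ℝ) (p : Fin 2 → ℝ),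
        (∃ m : ℝ, Oloid.Touches lam t m ∧ D t m = p) ↔
          1 + lam * Real.cos (Oloid.h t) ≠ 0 ∧ p = Oloid.kappaStar lam t) ∧
      {p : Fin 2 → ℝ | ∃ t m : ℝ, Oloid.Touches lam t m ∧ D t m = p} =
        {p : Fin 2 → ℝ | ∃ t : ℝ, 1 + lam * Real.cos (Oloid.h t) ≠ 0 ∧
          p = Oloid.kappaStar lam t} := by
  refine ⟨⟨Oloid.dev, Oloid.isDevelopment_dev⟩, fun D hD lam => ?_⟩
  obtain rfl := hD.unique Oloid.isDevelopment_dev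
  have key : ∀ (t : ℝ) (p : Fin 2 → ℝ),
      (∃ m : ℝ, Oloid.Touches lam t m ∧ Oloid.dev t m = p) ↔
        1 + lam * Real.cos (Oloid.h t) ≠ 0 ∧ p = Oloid.kappaStar lam t := by
    intro t p
    simp only [Oloid.touches_iff, Oloid.cos_h]
    constructor
    · rintro ⟨m, ⟨hl, rfl⟩, rfl⟩
      exact ⟨hl, (Oloid.kappaStar_eq_dev hl).symm⟩
    · rintro ⟨hl, rfl⟩
      exact ⟨_, ⟨hl, rfl⟩, (Oloid.kappaStar_eq_dev hl).symm⟩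
  exact ⟨key, Set.ext fun p => exists_congr fun t => key t p⟩
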